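/- **Theorem 4.1.** In the complex Hilbert space $L^2(0,\pi)$ with $\langle f,g\rangle=\int_0^\pi f\bar g\,dx$ let $L_0y=-y''$ on $$\mathfrak D(L_0)=\{y\in W_2^2(0,\pi):\ y(0)=y(\pi),\ y'(0)=y'(\pi)\},$$ and for $\alpha\in\mathbb R$, $v\in L^2(0,\pi)$ let $L(\alpha,v)=L_0+\alpha\langle\cdot,v\rangle v$ with domain $\mathfrak D(L_0)$. Put $$v_\pm(x)=\tfrac12\bigl(v(x)\pm v(\pi-x)\bigr),$$ and denote the Fourier coefficients of $v$ by $$c_0(v)=\Bigl\langle v,\tfrac1{\sqrt\pi}\Bigr\rangle,\qquad c_k(v)=\Bigl\langle v,\sqrt{\tfrac2\pi}\cos 2kx\Bigr\rangle,\qquad s_k(v)=\Bigl\langle v,\sqrt{\tfrac2\pi}\sin 2kx\Bigr\rangle\quad(k\ge1).$$ Then the numbers $\alpha|c_k(v)|^2$ ($k\ge0$) and $\alpha|s_k(v)|^2$ ($k\ge1$) are uniquely determined by the two spectra $\sigma(L(\alpha,v_+))$ and $\sigma(L(\alpha,v_-))$, counted with multiplicity, the multiplicity of $z$ being $\dim\ker(L(\alpha,v_\pm)-z)$.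 That is, if $\alpha,\beta\in\mathbb R$ and $v,w\in L^2(0,\pi)$ are such that $L(\alpha,v_+)$ and $L(\beta,w_+)$ have the same spectrum with the same multiplicities, and so do $L(\alpha,v_-)$ and $L(\beta,w_-)$, then $$\alpha|c_k(v)|^2=\beta|c_k(w)|^2\ (k\ge0),\qquad \alpha|s_k(v)|^2=\beta|s_k(w)|^2\ (k\ge1).$$ -/

import Mathlib

open MeasureTheory Set
open scoped Real

noncomputable section

namespace NonlocalPeriodic

/-- Lebesgue measure on the interval `(0, π)`. -/
abbrev mu : Measure ℝ := volume.restrict (Ioo 0 π)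

/-- The complex Hilbert space `L²(0, π)`. -/
abbrev H : Type := Lp ℂ 2 mu

/-- `IsSecondDeriv y w`: the class `y ∈ L²(0, π)` belongs to the Sobolev space `W₂²(0, π)`,
satisfies `y(0) = y(π)` and `y'(0) = y'(π)`, and has second derivative `w ∈ L²(0, π)`.
Here `u` is the representative of `y` which is absolutely continuous on `[0, π]`, and `u'` is
the absolutely continuous representative of its derivative; absolute continuity is expressed by
the fundamental theorem of calculus. -/
def IsSecondDeriv (y w : H) : Prop :=
  ∃ u u' : ℝ → ℂ,
    (y : ℝ → ℂ) =ᵐ[mu] u ∧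
    (∀ x ∈ Icc 0 π, u x = u 0 + ∫ t in (0 : ℝ)..x, u' t) ∧
    (∀ x ∈ Icc 0 π, u' x = u' 0 + ∫ t in (0 : ℝ)..x, w t) ∧
    u 0 = u π ∧ u' 0 = u' π

lemma intervalIntegrable_coe (w : H) {x : ℝ} (hx : x ∈ Icc 0 π) :
    IntervalIntegrable (w : ℝ → ℂ) volume 0 x := by
  have h1 : Integrable (w : ℝ → ℂ) mu := (Lp.memLp w).integrable (by norm_num)
  have h2 : IntegrableOn (w : ℝ → ℂ) (Ioc 0 π) volume :=
    (integrableOn_Ioc_iff_integrableOn_Ioo (by simp)).2 h1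
  rw [intervalIntegrable_iff_integrableOn_Ioc_of_le hx.1]
  exact h2.mono_set (Ioc_subset_Ioc_right hx.2)

lemma continuousOn_of_primitive {u f : ℝ → ℂ} (hf : IntervalIntegrable f volume 0 π)
    (h : ∀ x ∈ Icc 0 π, u x = u 0 + ∫ t in (0 : ℝ)..x, f t) : ContinuousOn u (Icc 0 π) := by
  have h1 : ContinuousOn (fun x => ∫ t in (0 : ℝ)..x, f t) (uIcc 0 π) :=
    intervalIntegral.continuousOn_primitive_interval
      ((intervalIntegrable_iff' (by simp)).1 hf)
  rw [uIcc_of_le Real.pi_pos.le] at h1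
  exact (continuousOn_const.add h1).congr h

lemma intervalIntegrable_of_primitive {w : H} {u' : ℝ → ℂ}
    (h : ∀ x ∈ Icc 0 π, u' x = u' 0 + ∫ t in (0 : ℝ)..x, w t) {x : ℝ} (hx : x ∈ Icc 0 π) :
    IntervalIntegrable u' volume 0 x := by
  have hc := continuousOn_of_primitive
    (intervalIntegrable_coe w (x := π) ⟨Real.pi_pos.le, le_rfl⟩) h
  apply ContinuousOn.intervalIntegrable
  rw [uIcc_of_le hx.1]
  exact hc.mono (Icc_subset_Icc_right hx.2)

/-- The graph of the operator `y ↦ -y''` with periodic boundary conditions. -/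
def graphL0 : Submodule ℂ (H × H) where
  carrier := {p | IsSecondDeriv p.1 (-p.2)}
  zero_mem' := by
    refine ⟨0, 0, ?_, ?_, ?_, rfl, rfl⟩
    · exact Lp.coeFn_zero ℂ 2 mu
    · intro x _
      simp
    · intro x hx
      have : ∫ t in (0 : ℝ)..x, ((-(0 : H) : H) : ℝ → ℂ) t = 0 := by
        rw [intervalIntegral.integral_of_le hx.1, integral_Ioc_eq_integral_Ioo]
        apply integral_eq_zero_of_ae
        have h0 : ((-(0 : H) : H) : ℝ → ℂ) =ᵐ[mu] 0 := by
          rw [neg_zero]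
          exact Lp.coeFn_zero ℂ 2 mu
        exact ae_restrict_of_ae_restrict_of_subset (Ioo_subset_Ioo_right hx.2) h0
      change (0 : ℂ) = 0 + ∫ t in (0 : ℝ)..x, ((-(0 : H) : H) : ℝ → ℂ) t
      rw [this, add_zero]
  add_mem' := by
    rintro ⟨y₁, w₁⟩ ⟨y₂, w₂⟩ ⟨u₁, d₁, hy₁, hu₁, hd₁, hb₁, hc₁⟩ ⟨u₂, d₂, hy₂, hu₂, hd₂, hb₂, hc₂⟩
    refine ⟨u₁ + u₂, d₁ + d₂, ?_, ?_, ?_, ?_, ?_⟩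
    · exact (Lp.coeFn_add y₁ y₂).trans (hy₁.add hy₂)
    · intro x hx
      have := intervalIntegral.integral_add (intervalIntegrable_of_primitive hd₁ hx)
        (intervalIntegrable_of_primitive hd₂ hx)
      simp only [Pi.add_apply, this]
      rw [hu₁ x hx, hu₂ x hx]
      ring
    · intro x hx
      have e : ∫ t in (0 : ℝ)..x, ((-(w₁ + w₂) : H) : ℝ → ℂ) t
          = ∫ t in (0 : ℝ)..x, (((-w₁ : H) : ℝ → ℂ) t + ((-w₂ : H) : ℝ → ℂ) t) := by
        rw [neg_add]
        rw [intervalIntegral.integral_of_le hx.1, intervalIntegral.integral_of_le hx.1,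
          integral_Ioc_eq_integral_Ioo, integral_Ioc_eq_integral_Ioo]
        exact integral_congr_ae (ae_restrict_of_ae_restrict_of_subset (Ioo_subset_Ioo_right hx.2)
          (Lp.coeFn_add (-w₁) (-w₂)))
      have := intervalIntegral.integral_add (intervalIntegrable_coe (-w₁) hx)
        (intervalIntegrable_coe (-w₂) hx)
      simp only [Pi.add_apply, Prod.mk_add_mk]
      rw [e, this, hd₁ x hx, hd₂ x hx]
      ring
    · simp only [Pi.add_apply, hb₁, hb₂]
    · simp only [Pi.add_apply, hc₁, hc₂]
  smul_mem' := by
    rintro c ⟨y, w⟩ ⟨u, d, hy, hu, hd, hb, hc⟩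
    refine ⟨c • u, c • d, ?_, ?_, ?_, ?_, ?_⟩
    · exact (Lp.coeFn_smul c y).trans (hy.const_smul c)
    · intro x hx
      simp only [Pi.smul_apply, intervalIntegral.integral_smul]
      rw [hu x hx, smul_add]
    · intro x hx
      have e : ∫ t in (0 : ℝ)..x, ((-(c • w) : H) : ℝ → ℂ) t
          = ∫ t in (0 : ℝ)..x, c • ((-w : H) : ℝ → ℂ) t := by
        rw [← smul_neg]
        rw [intervalIntegral.integral_of_le hx.1, intervalIntegral.integral_of_le hx.1,
          integral_Ioc_eq_integral_Ioo, integral_Ioc_eq_integral_Ioo]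
        exact integral_congr_ae (ae_restrict_of_ae_restrict_of_subset (Ioo_subset_Ioo_right hx.2)
          (Lp.coeFn_smul c (-w)))
      simp only [Pi.smul_apply, Prod.smul_mk]
      rw [e, intervalIntegral.integral_smul, hd x hx, smul_add]
    · simp only [Pi.smul_apply, hb]
    · simp only [Pi.smul_apply, hc]

/-- A function that is a.e. zero and whose primitive condition makes it continuous vanishes
on `[0, π]`; then its derivative is a.e. zero. -/
lemma ae_zero_of_primitive {u f : ℝ → ℂ} (hf : IntervalIntegrable f volume 0 π)
    (h : ∀ x ∈ Icc 0 π, u x = u 0 + ∫ t in (0 : ℝ)..x, f t) (hu : u =ᵐ[mu] 0) :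
    f =ᵐ[mu] 0 := by
  have hc := continuousOn_of_primitive hf h
  have hz : EqOn u 0 (Ioo 0 π) :=
    Measure.eqOn_open_of_ae_eq hu isOpen_Ioo (hc.mono Ioo_subset_Icc_self) continuousOn_const
  have hz' : EqOn u 0 (Icc 0 π) := by
    refine hz.of_subset_closure hc continuousOn_const Ioo_subset_Icc_self ?_
    rw [closure_Ioo Real.pi_pos.ne]
  have hint : ∀ x ∈ Icc 0 π, ∫ t in (0 : ℝ)..x, f t = 0 := by
    intro x hx
    have h1 := h x hx
    rw [hz' hx, hz' (⟨le_rfl, Real.pi_pos.le⟩ : (0 : ℝ) ∈ Icc 0 π)] at h1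
    simpa using h1.symm
  have hd := hf.ae_hasDerivAt_integral
  rw [Filter.EventuallyEq, ae_restrict_iff' measurableSet_Ioo]
  filter_upwards [hd] with x hx hxI
  have hx' : x ∈ uIcc 0 π := by
    rw [uIcc_of_le Real.pi_pos.le]
    exact Ioo_subset_Icc_self hxI
  have h1 := hx hx' 0 (by simp)
  have h2 : HasDerivAt (fun y => ∫ t in (0 : ℝ)..y, f t) 0 x := by
    refine (hasDerivAt_const x (0 : ℂ)).congr_of_eventuallyEq ?_
    filter_upwards [isOpen_Ioo.mem_nhds hxI] with y hy
    exact hint y (Ioo_subset_Icc_self hy)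
  exact h1.unique h2

/-- The second derivative is unique, so `graphL0` is the graph of an operator. -/
lemma graphL0_singleValued (p : H × H) (hp : p ∈ graphL0) (h0 : p.1 = 0) : p.2 = 0 := by
  obtain ⟨y, w⟩ := p
  obtain ⟨u, d, hy, hu, hd, -, -⟩ := hp
  have hpi : π ∈ Icc (0 : ℝ) π := ⟨Real.pi_pos.le, le_rfl⟩
  simp only at h0 hy hd ⊢
  subst h0
  have hu0 : u =ᵐ[mu] 0 := hy.symm.trans (Lp.coeFn_zero ℂ 2 mu)
  have hd0 := ae_zero_of_primitive (intervalIntegrable_of_primitive hd hpi) hu hu0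
  have hw0 := ae_zero_of_primitive (intervalIntegrable_coe (-w) hpi) hd hd0
  have : (-w : H) = 0 := (Lp.eq_zero_iff_ae_eq_zero).2 hw0
  simpa using this

/-- The operator `L₀ y = -y''` in `L²(0, π)` with domain
`{y ∈ W₂²(0, π) : y(0) = y(π), y'(0) = y'(π)}`. -/
def L0 : H →ₗ.[ℂ] H := graphL0.toLinearPMap

/-- `L₀` is the operator with graph `{(y, -y'')}`. -/
lemma graph_L0 : L0.graph = graphL0 :=
  Submodule.toLinearPMap_graph_eq _ graphL0_singleValued

/-- The rank-one operator `y ↦ α ⟨y, v⟩ v`, where `⟨y, v⟩ = ∫₀^π y(t) conj(v(t)) dt`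
(Mathlib's inner product is conjugate-linear in its first argument). -/
def rankOne (α : ℝ) (v : H) : H →ₗ[ℂ] H where
  toFun y := ((α : ℂ) * inner ℂ v y) • v
  map_add' y₁ y₂ := by rw [inner_add_right, mul_add, add_smul]
  map_smul' c y := by
    rw [inner_smul_right, RingHom.id_apply, smul_smul]
    congr 1
    ring

/-- `L(α, v) = L₀ + α ⟨·, v⟩ v` on the domain of `L₀`. -/
def L (α : ℝ) (v : H) : H →ₗ.[ℂ] H where
  domain := L0.domain
  toFun := L0.toFun + (rankOne α v).comp L0.domain.subtype

/-- `T - z` on the domain of `T`. -/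
def shift (T : H →ₗ.[ℂ] H) (z : ℂ) : T.domain →ₗ[ℂ] H :=
  T.toFun - z • T.domain.subtype

/-- The resolvent set: `T - z` maps the domain bijectively onto `H` with bounded inverse `R`. -/
def resolventSet (T : H →ₗ.[ℂ] H) : Set ℂ :=
  {z | ∃ R : H →L[ℂ] H,
    (∀ f : H, ∃ h : R f ∈ T.domain, shift T z ⟨R f, h⟩ = f) ∧
    ∀ y : T.domain, R (shift T z y) = y}

/-- The spectrum of an operator in `L²(0, π)`. -/
def spectrumOf (T : H →ₗ.[ℂ] H) : Set ℂ := (resolventSet T)ᶜ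

/-- The spectral multiplicity of `z`, the dimension of the eigenspace `ker (T - z)`. -/
def multiplicity (T : H →ₗ.[ℂ] H) (z : ℂ) : ℕ :=
  Module.finrank ℂ (LinearMap.ker (shift T z))

/-- `T` and `S` have the same spectrum, every point being taken with its multiplicity. -/
def SameSpectrum (T S : H →ₗ.[ℂ] H) : Prop :=
  spectrumOf T = spectrumOf S ∧ ∀ z ∈ spectrumOf T, multiplicity T z = multiplicity S z

lemma measurePreserving_reflection : MeasurePreserving (fun x : ℝ => π - x) mu mu := by
  have h := (Measure.measurePreserving_sub_left (volume : Measure ℝ) π).restrict_preimage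
    (measurableSet_Ioo (a := (0 : ℝ)) (b := π))
  simpa using h

/-- The reflection `f ↦ f(π - ·)` of `L²(0, π)`. -/
def reflection : H →ₗ[ℂ] H :=
  Lp.compMeasurePreservingₗ ℂ (fun x : ℝ => π - x) measurePreserving_reflection

/-- `v₊(x) = (v(x) + v(π - x)) / 2`. -/
def evenPart (v : H) : H := (1 / 2 : ℂ) • (v + reflection v)

/-- `v₋(x) = (v(x) - v(π - x)) / 2`. -/
def oddPart (v : H) : H := (1 / 2 : ℂ) • (v - reflection v)

/-- The normalized cosine `√(2/π) cos 2kx`, and `1/√π` for `k = 0`. -/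
def cosMode (k : ℕ) (x : ℝ) : ℝ :=
  if k = 0 then 1 / √π else √(2 / π) * Real.cos (2 * k * x)

/-- The normalized sine `√(2/π) sin 2kx` (identically zero for `k = 0`). -/
def sinMode (k : ℕ) (x : ℝ) : ℝ := √(2 / π) * Real.sin (2 * k * x)

/-- The Fourier coefficient `c_k(v)`. -/
def cosCoeff (k : ℕ) (v : H) : ℂ := ∫ x in (0 : ℝ)..π, v x * (cosMode k x : ℂ)

/-- The Fourier coefficient `s_k(v)`. -/
def sinCoeff (k : ℕ) (v : H) : ℂ := ∫ x in (0 : ℝ)..π, v x * (sinMode k x : ℂ)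

end NonlocalPeriodic

end

open scoped Topology

noncomputable section

namespace NonlocalPeriodic

/-! In the basis e^{2ikx}/√π the operator L₀ is diagonal with entries 4k², so L(α, v) is a rank-one
perturbation of a diagonal operator. With a_k = |v_k|², everything is encoded in F(z) = 1 + α ∑
a_k/(4k² - z): passing from L₀ to L(α, v) changes the dimension of the eigenspace at z by exactly
the order of F at z (`finrank_perturbedEigenspace`, `meromorphicOrderAt_charFun`). The order is 1, 0
or -1, because the a_k are nonnegative: all zeros of F are real, and away from the poles F' has the
sign of α on the real axis.

Equal spectra therefore give two functions F with equal orders everywhere. Their quotient extends to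
an entire function; it tends to 1 uniformly on the circles |z| = (2N+1)², which run between the
poles, so by the maximum principle it is identically 1. Comparing polar parts gives equality of α ∑
a_k over each group 4k² = z₀ (`residueSum_eq_of_shiftIndex_eq`).

The eigenvalue 4n², n ≥ 1, is double, and for v itself only |v_n|² + |v_{-n}|² would be visible.
Reflection swaps n and -n, so for v₊ and v₋ this sum is |c_n|² and |s_n|² respectively. -/

/-! ### Cauchy sums with poles at 4k² -/

/-- The Cauchy-type sum `∑ c_k / (4 k² - z)`. -/
def cauchySum (c : ℤ → ℂ) (z : ℂ) : ℂ := ∑' k : ℤ, c k / (4 * (k : ℂ) ^ 2 - z)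

lemma finite_norm_sub_lt (z : ℂ) (r : ℝ) : {k : ℤ | ‖4 * (k : ℂ) ^ 2 - z‖ < r}.Finite := by
  obtain ⟨N, hN⟩ := exists_nat_gt (r + ‖z‖)
  refine (Set.finite_Icc (-(N : ℤ)) N).subset fun k hk => ?_
  have h1 : ‖4 * (k : ℂ) ^ 2‖ ≤ ‖4 * (k : ℂ) ^ 2 - z‖ + ‖z‖ := by
    linarith [norm_sub_norm_le (4 * (k : ℂ) ^ 2) z]
  have h2 : ‖4 * (k : ℂ) ^ 2‖ = 4 * (k : ℝ) ^ 2 := by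
    rw [norm_mul, norm_pow, Complex.norm_intCast, sq_abs]
    simp
  have h3 : ((4 * k ^ 2 : ℤ) : ℝ) < ((N : ℤ) : ℝ) := by
    push_cast
    simp only [mem_ofPred_eq] at hk
    linarith
  have h4 : 4 * k ^ 2 < (N : ℤ) := by exact_mod_cast h3
  constructor <;> nlinarith

lemma exists_gap (z : ℂ) :
    ∃ δ > 0, ∀ k : ℤ, 4 * (k : ℂ) ^ 2 ≠ z → δ ≤ ‖4 * (k : ℂ) ^ 2 - z‖ := by
  have hfin : ({k : ℤ | ‖4 * (k : ℂ) ^ 2 - z‖ < 1} ∩ {k | 4 * (k : ℂ) ^ 2 ≠ z}).Finite :=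
    (finite_norm_sub_lt z 1).inter_of_left _
  rcases Set.eq_empty_or_nonempty
    ({k : ℤ | ‖4 * (k : ℂ) ^ 2 - z‖ < 1} ∩ {k | 4 * (k : ℂ) ^ 2 ≠ z}) with h | h
  · refine ⟨1, one_pos, fun k hk => ?_⟩
    by_contra hlt
    exact Set.eq_empty_iff_forall_notMem.1 h k ⟨not_le.1 hlt, hk⟩
  · obtain ⟨m, hm, hmin⟩ := Set.exists_min_image _ (fun k : ℤ => ‖4 * (k : ℂ) ^ 2 - z‖) hfin h
    refine ⟨‖4 * (m : ℂ) ^ 2 - z‖, norm_pos_iff.2 (sub_ne_zero.2 hm.2), fun k hk => ?_⟩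
    by_cases hlt : ‖4 * (k : ℂ) ^ 2 - z‖ < 1
    · exact hmin k ⟨hlt, hk⟩
    · have h1 : ‖4 * (m : ℂ) ^ 2 - z‖ < 1 := hm.1
      linarith

/-- No index has to be excluded: when 4k² = z, division by zero makes the term vanish. -/
lemma norm_div_le_of_gap {z : ℂ} {δ : ℝ} (hδ : 0 < δ)
    (h : ∀ k : ℤ, 4 * (k : ℂ) ^ 2 ≠ z → δ ≤ ‖4 * (k : ℂ) ^ 2 - z‖) (c : ℤ → ℂ) (k : ℤ) :
    ‖c k / (4 * (k : ℂ) ^ 2 - z)‖ ≤ ‖c k‖ * δ⁻¹ := by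
  rw [norm_div, div_eq_mul_inv]
  refine mul_le_mul_of_nonneg_left ?_ (norm_nonneg _)
  by_cases hk : 4 * (k : ℂ) ^ 2 = z
  · simp [hk, hδ.le]
  · exact inv_anti₀ hδ (h k hk)

lemma summable_norm_div {c : ℤ → ℂ} (hc : Summable fun k => ‖c k‖) (z : ℂ) :
    Summable fun k : ℤ => ‖c k / (4 * (k : ℂ) ^ 2 - z)‖ := by
  obtain ⟨δ, hδ, h⟩ := exists_gap z
  exact (hc.mul_right δ⁻¹).of_nonneg_of_le (fun _ => norm_nonneg _)
    (norm_div_le_of_gap hδ h c)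

lemma gap_half {z₀ : ℂ} {δ : ℝ}
    (h : ∀ k : ℤ, 4 * (k : ℂ) ^ 2 ≠ z₀ → δ ≤ ‖4 * (k : ℂ) ^ 2 - z₀‖) {z : ℂ}
    (hz : z ∈ Metric.ball z₀ (δ / 2)) {k : ℤ} (hk : 4 * (k : ℂ) ^ 2 ≠ z₀) :
    δ / 2 ≤ ‖4 * (k : ℂ) ^ 2 - z‖ := by
  have h1 := h k hk
  have h2 : ‖4 * (k : ℂ) ^ 2 - z₀‖ ≤ ‖4 * (k : ℂ) ^ 2 - z‖ + ‖z - z₀‖ :=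
    norm_sub_le_norm_sub_add_norm_sub _ _ _
  rw [Metric.mem_ball, dist_eq_norm] at hz
  linarith

/-- On the ball of half the gap radius the terms are dominated by a summable sequence, and those
with a pole at z₀ have coefficient zero; Weierstrass' theorem applies. -/
lemma analyticAt_cauchySum {c : ℤ → ℂ} (hc : Summable fun k => ‖c k‖) {z₀ : ℂ}
    (h0 : ∀ k : ℤ, 4 * (k : ℂ) ^ 2 = z₀ → c k = 0) : AnalyticAt ℂ (cauchySum c) z₀ := by
  obtain ⟨δ, hδ, h⟩ := exists_gap z₀
  have hd : DifferentiableOn ℂ (cauchySum c) (Metric.ball z₀ (δ / 2)) := by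
    refine Complex.differentiableOn_tsum_of_summable_norm (hc.mul_right (δ / 2)⁻¹) ?_
      Metric.isOpen_ball ?_
    · intro k
      by_cases hk : 4 * (k : ℂ) ^ 2 = z₀
      · simp only [h0 k hk, zero_div]
        exact differentiableOn_const _
      · intro z hz
        have hne : 4 * (k : ℂ) ^ 2 - z ≠ 0 :=
          norm_pos_iff.1 ((half_pos hδ).trans_le (gap_half h hz hk))
        exact ((differentiableAt_const _).div
          ((differentiableAt_const _).sub differentiableAt_id) hne).differentiableWithinAt
    · intro k z hz
      by_cases hk : 4 * (k : ℂ) ^ 2 = z₀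
      · simp [h0 k hk]
      · rw [norm_div, div_eq_mul_inv]
        gcongr
        exact gap_half h hz hk
  exact hd.analyticAt (Metric.ball_mem_nhds _ (half_pos hδ))

/-! ### Polar parts, zeros and orders of 1 + α ∑ a_k/(4k² - z) -/

/-- The sum of the coefficients attached to the pole `z₀`. -/
def residueSum (a : ℤ → ℝ) (z₀ : ℂ) : ℝ := ∑' k : ℤ, {k : ℤ | 4 * (k : ℂ) ^ 2 = z₀}.indicator a k

/-- The coefficients not attached to the pole `z₀`. -/
def offPole (a : ℤ → ℝ) (z₀ : ℂ) : ℤ → ℝ := {k : ℤ | 4 * (k : ℂ) ^ 2 = z₀}ᶜ.indicator a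

/-- The function `1 + α ∑ a_k / (4 k² - z)`. -/
def charFun (α : ℝ) (a : ℤ → ℝ) (z : ℂ) : ℂ := 1 + α * cauchySum (fun k => (a k : ℂ)) z

variable {α β : ℝ} {a b : ℤ → ℝ}

lemma offPole_nonneg (ha : 0 ≤ a) (z₀ : ℂ) : 0 ≤ offPole a z₀ :=
  fun k => Set.indicator_nonneg (fun _ _ => ha _) k

lemma offPole_eq_zero {z₀ : ℂ} {k : ℤ} (hk : 4 * (k : ℂ) ^ 2 = z₀) : offPole a z₀ k = 0 :=
  Set.indicator_of_notMem (s := {k : ℤ | 4 * (k : ℂ) ^ 2 = z₀}ᶜ) (Set.notMem_compl_iff.2 hk) a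

lemma summable_norm_ofReal (hs : Summable a) : Summable fun k => ‖(a k : ℂ)‖ := by
  simpa using hs.abs

lemma summable_offPole (hs : Summable a) (z₀ : ℂ) : Summable (offPole a z₀) := hs.indicator _

lemma analyticAt_cauchySum_offPole (hs : Summable a) (z₀ : ℂ) :
    AnalyticAt ℂ (cauchySum fun k => (offPole a z₀ k : ℂ)) z₀ :=
  analyticAt_cauchySum (summable_norm_ofReal (summable_offPole hs z₀))
    fun k hk => by simp [offPole_eq_zero hk]

/-- The polar part at z₀ is split off. At z = z₀ the identity persists, since the polar terms are
zero on both sides by the convention for division by zero. -/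
lemma cauchySum_eq (hs : Summable a) (z₀ z : ℂ) :
    cauchySum (fun k => (a k : ℂ)) z =
      residueSum a z₀ / (z₀ - z) + cauchySum (fun k => (offPole a z₀ k : ℂ)) z := by
  have h1 : Summable fun k : ℤ =>
      (({k : ℤ | 4 * (k : ℂ) ^ 2 = z₀}.indicator a k : ℝ) : ℂ) / (z₀ - z) :=
    (Complex.ofRealCLM.summable (hs.indicator _)).div_const _
  have h2 := (summable_norm_div (summable_norm_ofReal (summable_offPole hs z₀)) z).of_norm
  rw [cauchySum, cauchySum, residueSum, Complex.ofReal_tsum, ← tsum_div_const,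
    ← h1.tsum_add h2]
  congr 1
  ext k
  by_cases hk : 4 * (k : ℂ) ^ 2 = z₀
  · rw [offPole_eq_zero hk, Set.indicator_of_mem (by exact hk), hk]
    simp
  · rw [Set.indicator_of_notMem (by exact hk), offPole, Set.indicator_of_mem (by exact hk)]
    simp

lemma charFun_eq (hs : Summable a) (z₀ z : ℂ) :
    charFun α a z = (α * residueSum a z₀ : ℝ) / (z₀ - z) + charFun α (offPole a z₀) z := by
  rw [charFun, charFun, cauchySum_eq hs z₀ z]
  push_cast
  ring

lemma analyticAt_charFun_offPole (hs : Summable a) (z₀ : ℂ) :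
    AnalyticAt ℂ (charFun α (offPole a z₀)) z₀ :=
  analyticAt_const.add (analyticAt_const.mul (analyticAt_cauchySum_offPole hs z₀))

lemma meromorphicAt_charFun (hs : Summable a) (z₀ : ℂ) : MeromorphicAt (charFun α a) z₀ := by
  have h : charFun α a = fun z => (α * residueSum a z₀ : ℝ) / (z₀ - z)
      + charFun α (offPole a z₀) z := funext (charFun_eq hs z₀)
  rw [h]
  exact ((MeromorphicAt.const _ _).div
    ((MeromorphicAt.const _ _).sub (MeromorphicAt.id _))).add
      (analyticAt_charFun_offPole hs z₀).meromorphicAt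

/-- Recovers the wanted numbers from the function. The factor z₀ - z follows the denominators 4k² -
z; the limit is minus the usual residue. -/
lemma tendsto_sub_mul_charFun (hs : Summable a) (z₀ : ℂ) :
    Filter.Tendsto (fun z => (z₀ - z) * charFun α a z) (𝓝[≠] z₀)
      (𝓝 ((α * residueSum a z₀ : ℝ) : ℂ)) := by
  have h1 : Filter.Tendsto (fun z => ((α * residueSum a z₀ : ℝ) : ℂ)
      + (z₀ - z) * charFun α (offPole a z₀) z) (𝓝[≠] z₀)
      (𝓝 ((α * residueSum a z₀ : ℝ) + (z₀ - z₀) * charFun α (offPole a z₀) z₀)) := by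
    have hc := (analyticAt_charFun_offPole (α := α) hs z₀).continuousAt
    exact ((continuousAt_const.add ((continuousAt_const.sub continuousAt_id).mul hc)).tendsto).mono_left
      nhdsWithin_le_nhds
  rw [sub_self, zero_mul, add_zero] at h1
  refine h1.congr' ?_
  filter_upwards [self_mem_nhdsWithin] with z hz
  have : z₀ - z ≠ 0 := sub_ne_zero.2 (Ne.symm hz)
  rw [charFun_eq hs z₀ z]
  field_simp

lemma hasSum_cauchySum (hs : Summable a) (z : ℂ) :
    HasSum (fun k : ℤ => (a k : ℂ) / (4 * (k : ℂ) ^ 2 - z))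
      (cauchySum (fun k => (a k : ℂ)) z) :=
  (summable_norm_div (summable_norm_ofReal hs) z).of_norm.hasSum

/-- Zeros of `1 + α ∑ a_k / (4 k² - z)` are real. -/
lemma im_eq_zero_of_charFun_eq_zero (ha : 0 ≤ a) (hs : Summable a) {z : ℂ}
    (hz : charFun α a z = 0) : z.im = 0 := by
  by_contra him
  have hα : α ≠ 0 := by
    rintro rfl
    simp [charFun] at hz
  have h1 := Complex.hasSum_im (hasSum_cauchySum hs z)
  have h2 : (cauchySum (fun k => (a k : ℂ)) z).im = 0 := by
    have := congrArg Complex.im hz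
    simpa [charFun, hα] using this
  -- Herglotz property: each imaginary part is Im z times a nonnegative number. A vanishing sum
  -- forces every a_k to be zero, and then the function is 1.
  have hterm : ∀ k : ℤ, ((a k : ℂ) / (4 * (k : ℂ) ^ 2 - z)).im
      = z.im * (a k / Complex.normSq (4 * (k : ℂ) ^ 2 - z)) := by
    intro k
    have hk : (4 * (k : ℂ) ^ 2 : ℂ) = ((4 * (k : ℝ) ^ 2 : ℝ) : ℂ) := by push_cast; ring
    rw [Complex.div_im, hk]
    simp only [Complex.sub_im, Complex.ofReal_im, Complex.ofReal_re]
    ring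
  simp only [hterm, h2] at h1
  have h3 := h1.mul_left z.im⁻¹
  simp only [inv_mul_cancel_left₀ him, mul_zero] at h3
  have h4 := (hasSum_zero_iff_of_nonneg
    (fun k => div_nonneg (ha k) (Complex.normSq_nonneg _))).1 h3
  have h5 : ∀ k, a k = 0 := by
    intro k
    have := congrFun h4 k
    have hne : Complex.normSq (4 * (k : ℂ) ^ 2 - z) ≠ 0 := by
      rw [Ne, Complex.normSq_eq_zero, sub_eq_zero]
      rintro h
      apply him
      rw [← h]
      have hk : (4 * (k : ℂ) ^ 2 : ℂ) = ((4 * (k : ℝ) ^ 2 : ℝ) : ℂ) := by push_cast; ring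
      rw [hk, Complex.ofReal_im]
    simpa [hne] using this
  simp [charFun, cauchySum, h5] at hz

/-- The order of `1 + α ∑ a_k / (4 k² - z)` at `z`, equal to the change in the multiplicity
of `z` under the rank-one perturbation. -/
def shiftIndex (α : ℝ) (a : ℤ → ℝ) (z : ℂ) : ℤ :=
  open Classical in
  if α * residueSum a z = 0 then (if charFun α a z = 0 then 1 else 0) else -1

/-- Zeros of `1 + α ∑ a_k / (4 k² - z)` away from the poles are simple. -/
lemma exists_simple_zero (ha : 0 ≤ a) (hs : Summable a) {z₀ : ℂ}
    (hoff : ∀ k : ℤ, 4 * (k : ℂ) ^ 2 = z₀ → a k = 0) (hz : charFun α a z₀ = 0) :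
    ∃ g : ℂ → ℂ, AnalyticAt ℂ g z₀ ∧ g z₀ ≠ 0 ∧ ∀ᶠ z in 𝓝 z₀, charFun α a z = (z - z₀) * g z := by
  have him := im_eq_zero_of_charFun_eq_zero ha hs hz
  have hα : α ≠ 0 := by
    rintro rfl
    simp [charFun] at hz
  obtain ⟨x, rfl⟩ : ∃ x : ℝ, z₀ = x := ⟨z₀.re, by apply Complex.ext <;> simp [him]⟩
  -- Coefficients of the difference quotient: 1/(4k²-z) - 1/(4k²-x) = (z-x)/((4k²-x)(4k²-z)). At z =
  -- x the cofactor is α ∑ a_k/(4k²-x)², nonzero because x is real and not all a_k vanish.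
  set c : ℤ → ℂ := fun k => (a k : ℂ) / (4 * (k : ℂ) ^ 2 - x) with hc
  have hcs : Summable fun k => ‖c k‖ := summable_norm_div (summable_norm_ofReal hs) x
  refine ⟨fun z => α * cauchySum c z, analyticAt_const.mul (analyticAt_cauchySum hcs ?_), ?_, ?_⟩
  · intro k hk
    simp [hc, hk]
  · refine mul_ne_zero (by exact_mod_cast hα) ?_
    have hreal : ∀ k : ℤ, c k / (4 * (k : ℂ) ^ 2 - x)
        = ((a k / (4 * (k : ℝ) ^ 2 - x) ^ 2 : ℝ) : ℂ) := by
      intro k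
      push_cast
      rw [hc, div_div, sq]
      ring
    intro h0
    have hsum := (summable_norm_div hcs x).of_norm.hasSum
    change HasSum _ (cauchySum c x) at hsum
    rw [h0] at hsum
    simp only [hreal] at hsum
    have h2 : HasSum (fun k : ℤ => a k / (4 * (k : ℝ) ^ 2 - x) ^ 2) 0 := by
      refine Complex.hasSum_ofReal.1 ?_
      simpa only [Complex.ofReal_zero] using hsum
    have h4 := (hasSum_zero_iff_of_nonneg
      (fun k => div_nonneg (ha k) (sq_nonneg _))).1 h2
    have h5 : ∀ k, a k = 0 := by
      intro k
      by_cases hk : 4 * (k : ℂ) ^ 2 = x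
      · exact hoff k hk
      · have hne : 4 * (k : ℝ) ^ 2 - x ≠ 0 := by
          rw [sub_ne_zero]
          exact_mod_cast hk
        have := congrFun h4 k
        simpa [hne] using this
    simp [charFun, cauchySum, h5] at hz
  · obtain ⟨δ, hδ, h⟩ := exists_gap (x : ℂ)
    filter_upwards [Metric.ball_mem_nhds (x : ℂ) (half_pos hδ)] with z hzb
    have h1 : charFun α a z = charFun α a z - charFun α a x := by rw [hz, sub_zero]
    rw [h1, charFun, charFun]
    have h2 : cauchySum (fun k => (a k : ℂ)) z - cauchySum (fun k => (a k : ℂ)) x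
        = (z - x) * cauchySum c z := by
      have h3 := (hasSum_cauchySum hs z).sub (hasSum_cauchySum hs x)
      have h4 := ((summable_norm_div hcs z).of_norm.hasSum).mul_left (z - x)
      refine h3.unique (h4.congr_fun ?_)
      intro k
      by_cases hk : 4 * (k : ℂ) ^ 2 = x
      · simp [hc, hoff k hk]
      · have hne1 : 4 * (k : ℂ) ^ 2 - x ≠ 0 := sub_ne_zero.2 hk
        have hne2 : 4 * (k : ℂ) ^ 2 - z ≠ 0 :=
          norm_pos_iff.1 ((half_pos hδ).trans_le (gap_half h hzb hk))
        rw [hc]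
        field_simp
        ring
    linear_combination (α : ℂ) * h2

lemma charFun_eq_offPole (hs : Summable a) {z₀ : ℂ} (h : α * residueSum a z₀ = 0) :
    charFun α a = charFun α (offPole a z₀) := by
  ext z
  rw [charFun_eq hs z₀, h]
  simp

/-- If the polar part vanishes, the function equals its analytic part at z₀, which has a nonzero
value or a simple zero there; otherwise the pole is simple. -/
lemma meromorphicOrderAt_charFun (ha : 0 ≤ a) (hs : Summable a) (z₀ : ℂ) :
    meromorphicOrderAt (charFun α a) z₀ = (shiftIndex α a z₀ : WithTop ℤ) := by
  rw [meromorphicOrderAt_eq_int_iff (meromorphicAt_charFun hs z₀), shiftIndex]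
  have hA := analyticAt_charFun_offPole (α := α) hs z₀
  split_ifs with h1 h2
  · rw [charFun_eq_offPole hs h1] at h2 ⊢
    obtain ⟨g, hg, hg0, he⟩ := exists_simple_zero (offPole_nonneg ha z₀)
      (summable_offPole hs z₀) (fun k hk => offPole_eq_zero hk) h2
    refine ⟨g, hg, hg0, ?_⟩
    filter_upwards [he.filter_mono nhdsWithin_le_nhds] with z hz
    simpa using hz
  · rw [charFun_eq_offPole hs h1] at h2 ⊢
    exact ⟨_, hA, h2, by simp⟩
  · refine ⟨fun z => (z - z₀) * charFun α (offPole a z₀) z - (α * residueSum a z₀ : ℝ),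
      ((analyticAt_id.sub analyticAt_const).mul hA).sub analyticAt_const, ?_, ?_⟩
    · simp only [sub_self, zero_mul, zero_sub, neg_ne_zero]
      exact_mod_cast h1
    · filter_upwards [self_mem_nhdsWithin] with z hz
      have hne : z - z₀ ≠ 0 := sub_ne_zero.2 hz
      have hne' : z₀ - z ≠ 0 := sub_ne_zero.2 (Ne.symm hz)
      rw [charFun_eq hs z₀ z, zpow_neg_one, smul_eq_mul, ← neg_sub z z₀]
      field_simp
      ring

/-! ### Uniqueness from zeros and poles -/

/-- In the factorization of the difference of squares, 2|k| - (2N+1) is odd, hence at least 1 in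
absolute value, and the other factor is at least 2N+1. -/
lemma le_abs_four_mul_sq_sub (N : ℕ) (k : ℤ) :
    (2 * N + 1 : ℤ) ≤ |4 * k ^ 2 - (2 * N + 1) ^ 2| := by
  have h : 4 * k ^ 2 - (2 * N + 1 : ℤ) ^ 2
      = (2 * |k| - (2 * N + 1)) * (2 * |k| + (2 * N + 1)) := by
    nlinarith [sq_abs k]
  have hk := abs_nonneg k
  rw [h, abs_mul, abs_of_nonneg (by positivity : (0 : ℤ) ≤ 2 * |k| + (2 * N + 1))]
  have h1 : (1 : ℤ) ≤ |2 * |k| - (2 * N + 1)| := by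
    apply Int.one_le_abs
    omega
  nlinarith

lemma le_norm_four_mul_sq_sub {N : ℕ} {z : ℂ} (hz : ‖z‖ = (2 * N + 1) ^ 2) (k : ℤ) :
    (2 * N + 1 : ℝ) ≤ ‖4 * (k : ℂ) ^ 2 - z‖ := by
  have h1 := abs_norm_sub_norm_le (4 * (k : ℂ) ^ 2) z
  have h2 : ‖4 * (k : ℂ) ^ 2‖ = 4 * (k : ℝ) ^ 2 := by
    rw [norm_mul, norm_pow, Complex.norm_intCast, sq_abs]
    simp
  rw [h2, hz] at h1
  refine le_trans ?_ h1
  exact_mod_cast le_abs_four_mul_sq_sub N k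

lemma norm_charFun_sub_one_le (ha : 0 ≤ a) (hs : Summable a) {N : ℕ} {z : ℂ}
    (hz : ‖z‖ = (2 * N + 1) ^ 2) :
    ‖charFun α a z - 1‖ ≤ |α| * (∑' k, a k) / (2 * N + 1) := by
  have hN : (0 : ℝ) < 2 * N + 1 := by positivity
  have h1 : ∀ k : ℤ, ‖(a k : ℂ) / (4 * (k : ℂ) ^ 2 - z)‖ ≤ a k * (2 * N + 1 : ℝ)⁻¹ := by
    intro k
    have := norm_div_le_of_gap hN (fun k _ => le_norm_four_mul_sq_sub hz k)
      (fun k => (a k : ℂ)) k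
    rwa [Complex.norm_of_nonneg (ha k)] at this
  have h2 := tsum_of_norm_bounded (hs.mul_right _).hasSum h1
  rw [tsum_mul_right] at h2
  rw [charFun, add_sub_cancel_left, norm_mul, Complex.norm_real, Real.norm_eq_abs, mul_div_assoc,
    div_eq_mul_inv]
  gcongr
  exact h2

lemma analyticAt_charFun_of_norm_eq (hs : Summable a) {N : ℕ} {z : ℂ}
    (hz : ‖z‖ = (2 * N + 1) ^ 2) : AnalyticAt ℂ (charFun α a) z := by
  refine analyticAt_const.add (analyticAt_const.mul
    (analyticAt_cauchySum (summable_norm_ofReal hs) fun k hk => ?_))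
  have := le_norm_four_mul_sq_sub hz k
  rw [hk, sub_self, norm_zero] at this
  have hN : (0 : ℝ) < 2 * N + 1 := by positivity
  linarith

/-- A function `1 + α ∑ a_k / (4 k² - z)` is determined by its zeros and poles. -/
theorem residueSum_eq_of_shiftIndex_eq (ha : 0 ≤ a) (hsa : Summable a) (hb : 0 ≤ b)
    (hsb : Summable b) (h : ∀ z, shiftIndex α a z = shiftIndex β b z) (z₀ : ℂ) :
    α * residueSum a z₀ = β * residueSum b z₀ := by
  set Q : ℂ → ℂ := charFun α a / charFun β b with hQ
  have hma : MeromorphicOn (charFun α a) univ := fun z _ => meromorphicAt_charFun hsa z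
  have hmb : MeromorphicOn (charFun β b) univ := fun z _ => meromorphicAt_charFun hsb z
  have hmQ : MeromorphicOn Q univ := hma.div hmb
  have hord : ∀ z, meromorphicOrderAt Q z = 0 := by
    intro z
    rw [hQ, meromorphicOrderAt_div (hma z trivial) (hmb z trivial),
      meromorphicOrderAt_charFun ha hsa, meromorphicOrderAt_charFun hb hsb, h z]
    norm_cast
    simp
  -- All orders of the quotient are zero, but its values at zeros and poles of the two functions may
  -- be wrong; the normal form repairs them and is entire.
  set G := toMeromorphicNFOn Q univ with hG
  have hGan : ∀ z, AnalyticAt ℂ G z := by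
    intro z
    rw [← (meromorphicNFOn_toMeromorphicNFOn Q univ
      (mem_univ z)).meromorphicOrderAt_nonneg_iff_analyticAt,
      meromorphicOrderAt_toMeromorphicNFOn hmQ (mem_univ z), hord z]
  have hGQ : ∀ z, G =ᶠ[𝓝[≠] z] Q := fun z =>
    (hmQ.toMeromorphicNFOn_eq_self_on_nhdsNE (mem_univ z))
  set C : ℝ := |α| * (∑' k, a k) + |β| * (∑' k, b k) with hC
  have hCa : 0 ≤ |α| * (∑' k, a k) := mul_nonneg (abs_nonneg _) (tsum_nonneg ha)
  have hCb : 0 ≤ |β| * (∑' k, b k) := mul_nonneg (abs_nonneg _) (tsum_nonneg hb)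
  -- The condition on N keeps the denominator at least 1/2 in modulus on the circle, which is where
  -- the factor 2 comes from.
  have hcirc : ∀ N : ℕ, 2 * C ≤ 2 * N + 1 → ∀ z : ℂ, ‖z‖ = (2 * N + 1) ^ 2 →
      ‖G z - 1‖ ≤ 2 * (C / (2 * N + 1)) := by
    intro N hN z hz
    have hpos : (0 : ℝ) < 2 * N + 1 := by positivity
    have h1 := norm_charFun_sub_one_le (α := α) ha hsa hz
    have h2 := norm_charFun_sub_one_le (α := β) hb hsb hz
    have h3 : |β| * (∑' k, b k) / (2 * N + 1) ≤ 1 / 2 := by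
      rw [div_le_iff₀ hpos]
      linarith
    have h4 : 1 / 2 ≤ ‖charFun β b z‖ := by
      have := norm_sub_norm_le (1 : ℂ) (1 - charFun β b z)
      rw [norm_one, sub_sub_cancel, norm_sub_rev] at this
      linarith
    have hne : charFun β b z ≠ 0 := norm_pos_iff.1 (by linarith)
    have hQan : AnalyticAt ℂ Q z :=
      (analyticAt_charFun_of_norm_eq hsa hz).div (analyticAt_charFun_of_norm_eq hsb hz) hne
    have hval : G z = Q z :=
      (((hGan z).frequently_eq_iff_eventually_eq hQan).1 (hGQ z).frequently).self_of_nhds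
    have h5 : Q z - 1 = ((charFun α a z - 1) - (charFun β b z - 1)) / charFun β b z := by
      rw [hQ, Pi.div_apply]
      field_simp
      ring
    rw [hval, h5, norm_div, div_le_iff₀ (by linarith)]
    have h6 := norm_sub_le (charFun α a z - 1) (charFun β b z - 1)
    have h7 : 0 ≤ C / (2 * N + 1) := div_nonneg (add_nonneg hCa hCb) hpos.le
    have h8 : C / (2 * N + 1) = |α| * (∑' k, a k) / (2 * N + 1)
        + |β| * (∑' k, b k) / (2 * N + 1) := by rw [hC, add_div]
    nlinarith
  have hone : ∀ z, G z = 1 := by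
    intro z
    have hlim : Filter.Tendsto (fun N : ℕ => 2 * (C / (2 * (N : ℝ) + 1))) Filter.atTop (𝓝 0) := by
      have h1 : Filter.Tendsto (fun N : ℕ => 2 * (N : ℝ) + 1) Filter.atTop Filter.atTop :=
        Filter.tendsto_atTop_add_const_right _ _
          (tendsto_natCast_atTop_atTop.const_mul_atTop two_pos)
      simpa using (h1.const_div_atTop C).const_mul 2
    have hle : ∀ᶠ N : ℕ in Filter.atTop, ‖G z - 1‖ ≤ 2 * (C / (2 * (N : ℝ) + 1)) := by
      filter_upwards [Filter.eventually_ge_atTop (⌈C⌉₊ + ⌈‖z‖⌉₊)] with N hN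
      have hN' : (⌈C⌉₊ : ℝ) + ⌈‖z‖⌉₊ ≤ N := by exact_mod_cast hN
      have hc1 := Nat.le_ceil C
      have hc2 := Nat.le_ceil ‖z‖
      have hc3 : (0 : ℝ) ≤ ⌈C⌉₊ := Nat.cast_nonneg _
      have hc4 : (0 : ℝ) ≤ ⌈‖z‖⌉₊ := Nat.cast_nonneg _
      have hR : (0 : ℝ) < (2 * N + 1) ^ 2 := by positivity
      have hd : DifferentiableOn ℂ (fun w => G w - 1) (Metric.closedBall 0 ((2 * N + 1) ^ 2)) :=
        fun w _ => ((hGan w).differentiableAt.sub_const 1).differentiableWithinAt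
      refine Complex.norm_le_of_forall_mem_frontier_norm_le (U := Metric.ball 0 ((2 * N + 1) ^ 2))
        (f := fun w => G w - 1) Metric.isBounded_ball ?_ ?_ ?_
      · apply DifferentiableOn.diffContOnCl
        rwa [closure_ball _ hR.ne']
      · intro w hw
        rw [frontier_ball _ hR.ne', mem_sphere_zero_iff_norm] at hw
        exact hcirc N (by linarith) w hw
      · rw [closure_ball _ hR.ne', mem_closedBall_zero_iff]
        nlinarith
    have := ge_of_tendsto hlim hle
    exact sub_eq_zero.1 (norm_le_zero_iff.1 this)
  have hev : ∀ᶠ z in 𝓝[≠] z₀, (z₀ - z) * charFun α a z = (z₀ - z) * charFun β b z := by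
    filter_upwards [hGQ z₀] with z hz
    rw [hone z, hQ, Pi.div_apply] at hz
    -- A zero denominator would give the quotient the value 0 instead of 1.
    have hne : charFun β b z ≠ 0 := by
      intro h0
      simp [h0] at hz
    rw [eq_div_iff hne, one_mul] at hz
    rw [hz]
  have := tendsto_nhds_unique ((tendsto_sub_mul_charFun hsa z₀).congr' hev)
    (tendsto_sub_mul_charFun (α := β) hsb z₀)
  exact_mod_cast this

/-! ### Eigenspaces of a rank-one perturbation of a diagonal operator -/

section Multiplicity

variable {E : Type*} [NormedAddCommGroup E] [InnerProductSpace ℂ E] (b : HilbertBasis ℤ ℂ E)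

/-- The squared absolute values of the coefficients of `v`. -/
def coeffSq (v : E) (k : ℤ) : ℝ := ‖b.repr v k‖ ^ 2

lemma coeffSq_nonneg (v : E) : 0 ≤ coeffSq b v := fun _ => sq_nonneg _

lemma summable_coeffSq (v : E) : Summable (coeffSq b v) := by
  have := (lp.memℓp (b.repr v)).summable (by norm_num)
  change Summable fun k => ‖b.repr v k‖ ^ 2
  simpa using this

/-- The eigenspace of the diagonal operator with entries `4 k²` for the eigenvalue `z`. -/
def diagEigenspace (z : ℂ) : Submodule ℂ E where
  carrier := {y | ∀ k : ℤ, (4 * (k : ℂ) ^ 2 - z) * b.repr y k = 0}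
  zero_mem' := by simp
  add_mem' := by
    intro x y hx hy k
    rw [map_add, lp.coeFn_add, Pi.add_apply, mul_add, hx k, hy k, add_zero]
  smul_mem' := by
    intro c x hx k
    rw [map_smul, lp.coeFn_smul, Pi.smul_apply, smul_eq_mul, mul_left_comm, hx k, mul_zero]

/-- The eigenspace of the rank-one perturbation `α ⟨·, v⟩ v` of the diagonal operator with
entries `4 k²`, in coordinates. -/
def perturbedEigenspace (α : ℝ) (v : E) (z : ℂ) : Submodule ℂ E where
  carrier := {y | ∀ k : ℤ, (4 * (k : ℂ) ^ 2 - z) * b.repr y k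
    + α * inner ℂ v y * b.repr v k = 0}
  zero_mem' := by simp
  add_mem' := by
    intro x y hx hy k
    rw [map_add, lp.coeFn_add, Pi.add_apply, inner_add_right]
    linear_combination hx k + hy k
  smul_mem' := by
    intro c x hx k
    rw [map_smul, lp.coeFn_smul, Pi.smul_apply, smul_eq_mul, inner_smul_right]
    linear_combination c * hx k

variable {b} {α : ℝ} {v y : E} {z : ℂ}

lemma eq_zero_of_repr_eq_zero (h : ∀ k, b.repr y k = 0) : y = 0 := by
  rw [← b.repr.map_eq_zero_iff]
  ext k
  simpa using h k

/-- An element is determined by its coefficients at the finitely many k with 4k² = z. Finiteness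
makes `finrank` the true dimension. -/
instance : FiniteDimensional ℂ (diagEigenspace b z) := by
  have hfin : Finite {k : ℤ | 4 * (k : ℂ) ^ 2 = z} := by
    refine Set.Finite.to_subtype ((finite_norm_sub_lt z 1).subset fun k hk => ?_)
    have hk' : 4 * (k : ℂ) ^ 2 = z := hk
    simp [hk']
  let f : diagEigenspace b z →ₗ[ℂ] ({k : ℤ | 4 * (k : ℂ) ^ 2 = z} → ℂ) :=
    { toFun := fun y k => b.repr (y : E) k
      map_add' := fun x y => by ext k; simp
      map_smul' := fun c x => by ext k; simp }
  refine FiniteDimensional.of_injective f ((injective_iff_map_eq_zero f).2 fun y hy => ?_)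
  refine Subtype.ext (eq_zero_of_repr_eq_zero (b := b) fun k => ?_)
  by_cases hk : 4 * (k : ℂ) ^ 2 = z
  · exact congrFun hy ⟨k, hk⟩
  · exact (mul_eq_zero.1 (y.2 k)).resolve_left (sub_ne_zero.2 hk)

lemma hasSum_inner_repr (b : HilbertBasis ℤ ℂ E) (v y : E) :
    HasSum (fun k => (starRingEnd ℂ) (b.repr v k) * b.repr y k) (inner ℂ v y) := by
  have := b.hasSum_inner_mul_inner v y
  simpa only [b.repr_apply_apply, inner_conj_symm] using this

lemma residueSum_eq_zero_iff :
    residueSum (coeffSq b v) z = 0 ↔ ∀ k : ℤ, 4 * (k : ℂ) ^ 2 = z → b.repr v k = 0 := by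
  have hs : HasSum ({k : ℤ | 4 * (k : ℂ) ^ 2 = z}.indicator (coeffSq b v))
      (residueSum (coeffSq b v) z) := ((summable_coeffSq b v).indicator _).hasSum
  have hnn : 0 ≤ {k : ℤ | 4 * (k : ℂ) ^ 2 = z}.indicator (coeffSq b v) :=
    fun k => Set.indicator_nonneg (fun _ _ => coeffSq_nonneg b v _) k
  constructor
  · intro h k hk
    rw [h] at hs
    have h1 := congrFun ((hasSum_zero_iff_of_nonneg hnn).1 hs) k
    rw [Set.indicator_of_mem (by exact hk)] at h1
    simpa [coeffSq] using h1
  · intro h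
    have h0 : {k : ℤ | 4 * (k : ℂ) ^ 2 = z}.indicator (coeffSq b v) = 0 :=
      Set.indicator_eq_zero'.2 (Set.disjoint_left.2 fun k hk hk' => hk (by simp [coeffSq, h k hk']))
    rw [residueSum, h0]
    simp

/-- The vector with coefficients `v_k / (4 k² - z)`, those with `4 k² = z` being zero. -/
lemma exists_resolvent_vector (b : HilbertBasis ℤ ℂ E) (v : E) (z : ℂ) :
    ∃ g : E, ∀ k : ℤ, b.repr g k = b.repr v k / (4 * (k : ℂ) ^ 2 - z) := by
  obtain ⟨δ, hδ, h⟩ := exists_gap z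
  have hmem : Memℓp (fun k : ℤ => b.repr v k / (4 * (k : ℂ) ^ 2 - z)) 2 := by
    refine memℓp_gen ?_
    have h1 := (summable_coeffSq b v).mul_right (δ⁻¹ ^ 2)
    refine h1.of_nonneg_of_le (fun k => by positivity) fun k => ?_
    have h2 := norm_div_le_of_gap hδ h (fun k => b.repr v k) k
    rw [coeffSq, ← mul_pow]
    simp only [ENNReal.toReal_ofNat, Real.rpow_ofNat]
    gcongr
  exact ⟨b.repr.symm ⟨_, hmem⟩, fun k => by simp⟩

/-- Parseval's identity; valid also when z is some 4k², since both sides omit these terms. -/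
lemma charFun_eq_inner {g : E} (hg : ∀ k : ℤ, b.repr g k = b.repr v k / (4 * (k : ℂ) ^ 2 - z)) :
    charFun α (coeffSq b v) z = 1 + α * inner ℂ v g := by
  rw [charFun]
  congr 2
  refine (hasSum_cauchySum (summable_coeffSq b v) z).unique
    ((hasSum_inner_repr b v g).congr_fun fun k => ?_)
  rw [hg, ← mul_div_assoc, Complex.conj_mul', coeffSq]
  push_cast
  rfl

/-- Unless α = 0, the supports of the coefficients of v and y are disjoint, so the perturbation
vanishes on the unperturbed eigenspace. -/
lemma mul_inner_eq_zero_of_mem_diagEigenspace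
    (h : α * residueSum (coeffSq b v) z = 0) (hy : y ∈ diagEigenspace b z) :
    (α : ℂ) * inner ℂ v y = 0 := by
  rcases mul_eq_zero.1 h with h | h
  · simp [h]
  · rw [residueSum_eq_zero_iff] at h
    have h0 : ∀ k, (starRingEnd ℂ) (b.repr v k) * b.repr y k = 0 := by
      intro k
      by_cases hk : 4 * (k : ℂ) ^ 2 = z
      · simp [h k hk]
      · rw [(mul_eq_zero.1 (hy k)).resolve_left (sub_ne_zero.2 hk), mul_zero]
    have := hasSum_inner_repr b v y
    simp only [h0] at this
    rw [this.unique hasSum_zero, mul_zero]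

/-- The multiplicity of `z` changes by `shiftIndex` under the rank-one perturbation. -/
theorem finrank_perturbedEigenspace (b : HilbertBasis ℤ ℂ E) (α : ℝ) (v : E) (z : ℂ) :
    (Module.finrank ℂ (perturbedEigenspace b α v z) : ℤ)
      = Module.finrank ℂ (diagEigenspace b z) + shiftIndex α (coeffSq b v) z := by
  obtain ⟨g, hg⟩ := exists_resolvent_vector b v z
  have hF := charFun_eq_inner (α := α) hg
  rw [shiftIndex]
  split_ifs with h1 h2
  · rw [hF] at h2
    have hα : α ≠ 0 := by
      rintro rfl
      simp at h2
    have hv : ∀ k : ℤ, 4 * (k : ℂ) ^ 2 = z → b.repr v k = 0 :=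
      residueSum_eq_zero_iff.1 ((mul_eq_zero.1 h1).resolve_left hα)
    have hgv : ∀ k : ℤ, (4 * (k : ℂ) ^ 2 - z) * b.repr g k = b.repr v k := by
      intro k
      by_cases hk : 4 * (k : ℂ) ^ 2 = z
      · simp [hk, hv k hk]
      · rw [hg, mul_div_cancel₀ _ (sub_ne_zero.2 hk)]
    have hg0 : g ≠ 0 := by
      rintro rfl
      simp at h2
    -- Here g solves (D - z)g = v for the diagonal operator D, and 1 + α⟨g, v⟩ = 0 makes g a new
    -- eigenvector. For any perturbed eigenvector y, the vector y + α⟨y, v⟩g is an unperturbed one.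
    have hsup : perturbedEigenspace b α v z = diagEigenspace b z ⊔ Submodule.span ℂ {g} := by
      apply le_antisymm
      · intro y hy
        rw [Submodule.mem_sup]
        refine ⟨y + (α * inner ℂ v y) • g, fun k => ?_, -((α * inner ℂ v y) • g),
          neg_mem (Submodule.smul_mem _ _ (Submodule.mem_span_singleton_self g)), by simp⟩
        have := hy k
        simp only [map_add, map_smul, lp.coeFn_add, Pi.add_apply, lp.coeFn_smul, Pi.smul_apply,
          smul_eq_mul]
        linear_combination this + (α * inner ℂ v y) * hgv k
      · refine sup_le (fun y hy k => ?_) ?_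
        · rw [hy k, mul_inner_eq_zero_of_mem_diagEigenspace h1 hy]
          ring
        · rw [Submodule.span_singleton_le_iff_mem]
          intro k
          linear_combination hgv k + b.repr v k * h2
    have hdisj : diagEigenspace b z ⊓ Submodule.span ℂ {g} = ⊥ := by
      rw [eq_bot_iff]
      rintro y ⟨hy, hyg⟩
      obtain ⟨c, rfl⟩ := Submodule.mem_span_singleton.1 hyg
      have := mul_inner_eq_zero_of_mem_diagEigenspace h1 hy
      rw [inner_smul_right] at this
      have hc : c = 0 := by linear_combination c * h2 - this
      simp [hc]
    have := Submodule.finrank_sup_add_finrank_inf_eq (diagEigenspace b z) (Submodule.span ℂ {g})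
    rw [hdisj, finrank_bot, add_zero, finrank_span_singleton hg0, ← hsup] at this
    rw [this]
    push_cast
    rfl
  · rw [hF] at h2
    have : perturbedEigenspace b α v z = diagEigenspace b z := by
      apply le_antisymm
      · intro y hy
        have hdiag : y + (α * inner ℂ v y) • g ∈ diagEigenspace b z := by
          intro k
          have := hy k
          simp only [map_add, map_smul, lp.coeFn_add, Pi.add_apply, lp.coeFn_smul, Pi.smul_apply,
            smul_eq_mul]
          by_cases hk : 4 * (k : ℂ) ^ 2 = z
          · simp [hk]
          · rw [hg]
            have hne := sub_ne_zero.2 hk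
            field_simp
            linear_combination this
        have h0 := mul_inner_eq_zero_of_mem_diagEigenspace h1 hdiag
        rw [inner_add_right, inner_smul_right] at h0
        -- Pairing the unperturbed eigenvector y + α⟨y, v⟩g with v gives this product; its second
        -- factor is nonzero, so the perturbation annihilates y.
        have h3 : (α * inner ℂ v y) * (1 + α * inner ℂ v g) = 0 := by linear_combination h0
        have h4 := (mul_eq_zero.1 h3).resolve_right h2
        rwa [h4, zero_smul, add_zero] at hdiag
      · intro y hy k
        rw [hy k, mul_inner_eq_zero_of_mem_diagEigenspace h1 hy]
        ring
    rw [this, add_zero]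
  · have hα : α ≠ 0 := left_ne_zero_of_mul h1
    have hr : ¬ ∀ k : ℤ, 4 * (k : ℂ) ^ 2 = z → b.repr v k = 0 :=
      fun h => right_ne_zero_of_mul h1 (residueSum_eq_zero_iff.2 h)
    push Not at hr
    obtain ⟨m, hm, hvm⟩ := hr
    -- Coordinate m of the eigenvalue equation reads α⟨y, v⟩v_m = 0. Hence the perturbed eigenspace
    -- is the hyperplane of unperturbed eigenvectors orthogonal to v, the kernel of φ.
    let φ : Module.Dual ℂ (diagEigenspace b z) :=
      (innerₛₗ ℂ v).comp (diagEigenspace b z).subtype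
    have hφ : ∀ y, φ y = inner ℂ v (y : E) := fun y => rfl
    have hφ0 : φ ≠ 0 := by
      intro h
      have hmem : b m ∈ diagEigenspace b z := by
        intro k
        by_cases hk : k = m
        · simp [hk, hm]
        · rw [b.repr_self, lp.single_apply_ne _ _ _ hk, mul_zero]
      have h5 := congrArg (fun f => f ⟨b m, hmem⟩) h
      simp only [hφ, LinearMap.zero_apply] at h5
      rw [← inner_conj_symm, ← b.repr_apply_apply, map_eq_zero] at h5
      exact hvm h5
    have hmap : perturbedEigenspace b α v z = (LinearMap.ker φ).map (diagEigenspace b z).subtype := by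
      ext y
      constructor
      · intro hy
        have hin : inner ℂ v y = 0 := by
          have := hy m
          rw [hm, sub_self, zero_mul, zero_add] at this
          simpa [hα, hvm] using this
        have hyd : y ∈ diagEigenspace b z := by
          intro k
          simpa [hin] using hy k
        exact ⟨⟨y, hyd⟩, hin, rfl⟩
      · rintro ⟨y, hy, rfl⟩ k
        have hin : inner ℂ v (y : E) = 0 := hy
        rw [Submodule.subtype_apply, hin, y.2 k]
        simp
    have h6 := Module.Dual.finrank_ker_add_one_of_ne_zero hφ0
    rw [hmap, Submodule.finrank_map_subtype_eq]
    rw [← h6]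
    push_cast
    ring

end Multiplicity

/-! ### The Fourier basis of L²(0, π) -/

/-- The normalized exponential `e^{2ikx} / √π`. -/
def expMode (k : ℤ) (x : ℝ) : ℂ := Complex.exp (2 * Complex.I * k * x) / √π

lemma continuous_expMode (k : ℤ) : Continuous (expMode k) := by
  unfold expMode
  fun_prop

lemma memLp_of_continuousOn {u : ℝ → ℂ} (hu : ContinuousOn u (Icc 0 π)) : MemLp u 2 mu := by
  obtain ⟨C, hC⟩ := isCompact_Icc.exists_bound_of_continuousOn hu
  refine MemLp.of_bound ((hu.mono Ioo_subset_Icc_self).aestronglyMeasurable measurableSet_Ioo) C ?_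
  filter_upwards [ae_restrict_mem measurableSet_Ioo] with x hx
  exact hC x (Ioo_subset_Icc_self hx)

lemma integral_mu (f : ℝ → ℂ) : ∫ x, f x ∂mu = ∫ x in (0 : ℝ)..π, f x := by
  rw [intervalIntegral.integral_of_le Real.pi_pos.le, integral_Ioc_eq_integral_Ioo]

lemma integral_congr_of_ae_mu {f g : ℝ → ℂ} (h : f =ᵐ[mu] g) :
    ∫ x in (0 : ℝ)..π, f x = ∫ x in (0 : ℝ)..π, g x := by
  rw [← integral_mu, ← integral_mu]
  exact integral_congr_ae h

/-- The class of `e^{2ikx} / √π` in `L²(0, π)`. -/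
def expLp (k : ℤ) : H := (memLp_of_continuousOn (continuous_expMode k).continuousOn).toLp

lemma coeFn_expLp (k : ℤ) : expLp k =ᵐ[mu] expMode k := MemLp.coeFn_toLp _

lemma conj_expMode (k : ℤ) (x : ℝ) : (starRingEnd ℂ) (expMode k x) = expMode (-k) x := by
  simp only [expMode, map_div₀, ← Complex.exp_conj, map_mul, Complex.conj_I, Complex.conj_ofReal,
    map_ofNat, map_intCast, Int.cast_neg]
  ring_nf

lemma inner_expLp (k : ℤ) (f : H) :
    inner ℂ (expLp k) f = ∫ x in (0 : ℝ)..π, f x * expMode (-k) x := by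
  rw [L2.inner_def, ← integral_mu]
  apply integral_congr_ae
  filter_upwards [coeFn_expLp k] with x hx
  rw [hx, RCLike.inner_apply, conj_expMode]

lemma expMode_mul_expMode (k l : ℤ) (x : ℝ) :
    expMode k x * expMode l x = Complex.exp (2 * Complex.I * ((k + l : ℤ) : ℂ) * x) / π := by
  have hpi : (√π : ℂ) * √π = π := by
    rw [← Complex.ofReal_mul, Real.mul_self_sqrt Real.pi_pos.le]
  rw [expMode, expMode, div_mul_div_comm, ← Complex.exp_add, hpi]
  congr 2
  push_cast
  ring

lemma exp_mul_pi (m : ℤ) : Complex.exp (2 * Complex.I * m * π) = 1 := by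
  rw [Complex.exp_eq_one_iff]
  exact ⟨m, by ring⟩

lemma orthonormal_expLp : Orthonormal ℂ expLp := by
  rw [orthonormal_iff_ite]
  intro k l
  have h1 : inner ℂ (expLp k) (expLp l)
      = ∫ x in (0 : ℝ)..π, Complex.exp (2 * Complex.I * ((l + -k : ℤ) : ℂ) * x) / π := by
    rw [inner_expLp]
    refine integral_congr_of_ae_mu ?_
    filter_upwards [coeFn_expLp l] with x hx
    rw [hx, expMode_mul_expMode]
  have hpi : (π : ℂ) ≠ 0 := by exact_mod_cast Real.pi_ne_zero
  rw [h1]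
  split_ifs with hkl
  · subst hkl
    simp [hpi]
  · have hne : 2 * Complex.I * ((l + -k : ℤ) : ℂ) ≠ 0 := by
      refine mul_ne_zero (mul_ne_zero two_ne_zero Complex.I_ne_zero) ?_
      exact_mod_cast fun h => hkl (by omega)
    rw [intervalIntegral.integral_div, integral_exp_mul_complex hne, exp_mul_pi]
    simp

/-- Completeness, from Parseval's identity for `fourierCoeffOn`: on an interval of length π its
characters are the modes up to the factor √π. -/
lemma eq_zero_of_inner_expLp_eq_zero {f : H} (h : ∀ k, inner ℂ (expLp k) f = 0) : f = 0 := by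
  have hL2 : MemLp f 2 (volume.restrict (Ioc 0 π)) := by
    rw [← restrict_Ioo_eq_restrict_Ioc]
    exact Lp.memLp f
  have hsq : (√π : ℂ) ≠ 0 := by
    exact_mod_cast (Real.sqrt_pos.2 Real.pi_pos).ne'
  have hcoef : ∀ k, fourierCoeffOn Real.pi_pos f k = 0 := by
    intro k
    rw [fourierCoeffOn_eq_integral]
    have h1 : ∫ x in (0 : ℝ)..π, fourier (-k) (x : AddCircle (π - 0)) • f x
        = ∫ x in (0 : ℝ)..π, (√π : ℂ) * (f x * expMode (-k) x) := by
      congr 1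
      ext x
      rw [fourier_coe_apply, smul_eq_mul, expMode]
      have hpi : (π : ℂ) ≠ 0 := by exact_mod_cast Real.pi_ne_zero
      have harg : 2 * (π : ℂ) * Complex.I * ((-k : ℤ) : ℂ) * x / ((π - 0 : ℝ) : ℂ)
          = 2 * Complex.I * ((-k : ℤ) : ℂ) * x := by
        rw [sub_zero]
        field_simp
      rw [harg]
      field_simp
    rw [h1, intervalIntegral.integral_const_mul, ← inner_expLp, h k]
    simp
  have hP := hasSum_sq_fourierCoeffOn Real.pi_pos hL2
  simp only [hcoef, norm_zero, ne_eq, OfNat.ofNat_ne_zero, not_false_eq_true, zero_pow,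
    sub_zero] at hP
  have h2 := hP.unique hasSum_zero
  rw [smul_eq_mul, mul_eq_zero] at h2
  have h3 := h2.resolve_left (inv_ne_zero Real.pi_ne_zero)
  have h4 : inner ℂ f f = (0 : ℂ) := by
    rw [L2.inner_def, integral_mu]
    have : ∀ x, inner ℂ (f x) (f x) = ((‖f x‖ ^ 2 : ℝ) : ℂ) := by
      intro x
      rw [inner_self_eq_norm_sq_to_K]
      norm_cast
    simp only [this]
    rw [intervalIntegral.integral_ofReal, h3, Complex.ofReal_zero]
  exact inner_self_eq_zero.1 h4

/-- The Fourier basis of `L²(0, π)`. -/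
def expBasis : HilbertBasis ℤ ℂ H :=
  HilbertBasis.mkOfOrthogonalEqBot orthonormal_expLp (by
    rw [eq_bot_iff]
    intro f hf
    refine eq_zero_of_inner_expLp_eq_zero fun k => ?_
    exact (Submodule.mem_orthogonal _ _).1 hf _ (Submodule.subset_span ⟨k, rfl⟩))

lemma expBasis_apply (k : ℤ) : expBasis k = expLp k :=
  congrFun (HilbertBasis.coe_mkOfOrthogonalEqBot _ _) k

lemma expBasis_repr (f : H) (k : ℤ) :
    expBasis.repr f k = ∫ x in (0 : ℝ)..π, f x * expMode (-k) x := by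
  rw [HilbertBasis.repr_apply_apply, expBasis_apply, inner_expLp]

lemma intervalIntegrable_mul_expMode (f : H) (k : ℤ) :
    IntervalIntegrable (fun x => f x * expMode k x) volume 0 π :=
  (intervalIntegrable_coe f ⟨Real.pi_pos.le, le_rfl⟩).mul_continuousOn
    (continuous_expMode k).continuousOn

lemma sqrt_two_div_pi : (√(2 / π) : ℂ) = √2 / √π := by
  rw [Real.sqrt_div zero_le_two]
  push_cast
  rfl

/-- The indices -k and -(-k) are those against which `expBasis_repr` integrates for the coefficients
at k and -k. -/
lemma cosMode_eq {k : ℕ} (hk : k ≠ 0) (x : ℝ) :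
    (cosMode k x : ℂ) = (expMode (-k) x + expMode (-(-k)) x) / √2 := by
  have h2 : (√2 : ℂ) ≠ 0 := by exact_mod_cast (Real.sqrt_pos.2 two_pos).ne'
  have h2' : (√2 : ℂ) * √2 = 2 := by
    rw [← Complex.ofReal_mul, Real.mul_self_sqrt zero_le_two]
    norm_num
  rw [cosMode, if_neg hk]
  push_cast
  rw [sqrt_two_div_pi, Complex.cos, expMode, expMode]
  push_cast
  have e1 : (2 * k * x : ℂ) * Complex.I = 2 * Complex.I * - -k * x := by ring
  have e2 : -(2 * k * x : ℂ) * Complex.I = 2 * Complex.I * -k * x := by ring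
  rw [e1, e2, eq_div_iff h2]
  linear_combination (Complex.exp (2 * Complex.I * - -k * x)
    + Complex.exp (2 * Complex.I * -k * x)) / 2 / √π * h2'

lemma sinMode_eq (k : ℕ) (x : ℝ) :
    (sinMode k x : ℂ) = (expMode (-k) x - expMode (-(-k)) x) * (Complex.I / √2) := by
  have h2 : (√2 : ℂ) ≠ 0 := by exact_mod_cast (Real.sqrt_pos.2 two_pos).ne'
  have h2' : (√2 : ℂ) * √2 = 2 := by
    rw [← Complex.ofReal_mul, Real.mul_self_sqrt zero_le_two]
    norm_num
  rw [sinMode]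
  push_cast
  rw [sqrt_two_div_pi, Complex.sin, expMode, expMode]
  push_cast
  have e1 : (2 * k * x : ℂ) * Complex.I = 2 * Complex.I * - -k * x := by ring
  have e2 : -(2 * k * x : ℂ) * Complex.I = 2 * Complex.I * -k * x := by ring
  rw [e1, e2, ← mul_div_assoc _ Complex.I, eq_div_iff h2]
  linear_combination (Complex.exp (2 * Complex.I * -k * x)
    - Complex.exp (2 * Complex.I * - -k * x)) * Complex.I / 2 / √π * h2'

lemma cosCoeff_zero (v : H) : cosCoeff 0 v = expBasis.repr v 0 := by
  rw [cosCoeff, expBasis_repr]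
  simp [cosMode, expMode]

lemma cosCoeff_eq {k : ℕ} (hk : k ≠ 0) (v : H) :
    cosCoeff k v = (expBasis.repr v k + expBasis.repr v (-k)) / √2 := by
  rw [cosCoeff, expBasis_repr, expBasis_repr,
    ← intervalIntegral.integral_add (intervalIntegrable_mul_expMode _ _)
      (intervalIntegrable_mul_expMode _ _), ← intervalIntegral.integral_div]
  congr 1
  ext x
  rw [cosMode_eq hk]
  ring

lemma sinCoeff_eq (k : ℕ) (v : H) :
    sinCoeff k v = (expBasis.repr v k - expBasis.repr v (-k)) * (Complex.I / √2) := by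
  rw [sinCoeff, expBasis_repr, expBasis_repr,
    ← intervalIntegral.integral_sub (intervalIntegrable_mul_expMode _ _)
      (intervalIntegrable_mul_expMode _ _), ← intervalIntegral.integral_mul_const]
  congr 1
  ext x
  rw [sinMode_eq]
  ring

/-! ### Reflection, even and odd parts -/

lemma expMode_pi_sub (k : ℤ) (x : ℝ) : expMode k (π - x) = expMode (-k) x := by
  rw [expMode, expMode]
  have : 2 * Complex.I * k * ((π - x : ℝ) : ℂ)
      = 2 * Complex.I * k * π + 2 * Complex.I * ((-k : ℤ) : ℂ) * x := by
    push_cast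
    ring
  rw [this, Complex.exp_add, exp_mul_pi, one_mul]

lemma expBasis_repr_reflection (v : H) (k : ℤ) :
    expBasis.repr (reflection v) k = expBasis.repr v (-k) := by
  rw [expBasis_repr, expBasis_repr]
  have h1 : reflection v =ᵐ[mu] fun x => v (π - x) :=
    Lp.coeFn_compMeasurePreserving v measurePreserving_reflection
  have h2 : ∫ x in (0 : ℝ)..π, reflection v x * expMode (-k) x
      = ∫ x in (0 : ℝ)..π, v (π - x) * expMode (- -k) (π - x) := by
    refine integral_congr_of_ae_mu ?_
    filter_upwards [h1] with x hx
    rw [hx, expMode_pi_sub]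
    simp
  rw [h2, intervalIntegral.integral_comp_sub_left (fun x => v x * expMode (- -k) x)]
  simp

lemma expBasis_repr_evenPart (v : H) (k : ℤ) :
    expBasis.repr (evenPart v) k = (expBasis.repr v k + expBasis.repr v (-k)) / 2 := by
  rw [evenPart, map_smul, map_add, lp.coeFn_smul, lp.coeFn_add, Pi.smul_apply, Pi.add_apply,
    expBasis_repr_reflection, smul_eq_mul]
  ring

lemma expBasis_repr_oddPart (v : H) (k : ℤ) :
    expBasis.repr (oddPart v) k = (expBasis.repr v k - expBasis.repr v (-k)) / 2 := by
  rw [oddPart, map_smul, map_sub, lp.coeFn_smul, lp.coeFn_sub, Pi.smul_apply, Pi.sub_apply,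
    expBasis_repr_reflection, smul_eq_mul]
  ring

lemma residueSum_zero (a : ℤ → ℝ) : residueSum a 0 = a 0 := by
  rw [residueSum, tsum_eq_single 0]
  · exact Set.indicator_of_mem (by simp) _
  · intro k hk
    exact Set.indicator_of_notMem (by simpa using hk) _

lemma residueSum_four_mul_sq {n : ℕ} (hn : n ≠ 0) (a : ℤ → ℝ) :
    residueSum a (4 * (n : ℂ) ^ 2) = a n + a (-n) := by
  have hset : {k : ℤ | 4 * (k : ℂ) ^ 2 = 4 * (n : ℂ) ^ 2} = {(n : ℤ), -(n : ℤ)} := by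
    ext k
    simp only [mem_ofPred_eq, mem_insert_iff, mem_singleton_iff]
    rw [← sq_eq_sq_iff_eq_or_eq_neg, mul_right_inj' (by norm_num : (4 : ℂ) ≠ 0)]
    norm_cast
  have hne : (n : ℤ) ≠ -(n : ℤ) := by omega
  rw [residueSum, hset, tsum_eq_sum (s := {(n : ℤ), -(n : ℤ)}), Finset.sum_pair hne]
  · simp
  · intro k hk
    exact Set.indicator_of_notMem (by simpa using hk) _

/-- For n ≥ 1 the coefficients at n and -n both equal (v_n + v_{-n})/2, so the sum is |v_n +
v_{-n}|²/2, while c_n = (v_n + v_{-n})/√2. For n = 0 there is a single index. -/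
lemma residueSum_evenPart (v : H) (n : ℕ) :
    residueSum (coeffSq expBasis (evenPart v)) (4 * (n : ℂ) ^ 2) = ‖cosCoeff n v‖ ^ 2 := by
  rcases eq_or_ne n 0 with rfl | hn
  · have h : (4 * ((0 : ℕ) : ℂ) ^ 2) = 0 := by simp
    rw [h, residueSum_zero, coeffSq, expBasis_repr_evenPart, cosCoeff_zero]
    simp
  · rw [residueSum_four_mul_sq hn, coeffSq, coeffSq, expBasis_repr_evenPart,
      expBasis_repr_evenPart, neg_neg, add_comm (expBasis.repr v (-(n : ℤ))), cosCoeff_eq hn]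
    simp only [norm_div, div_pow, Complex.norm_real, Complex.norm_ofNat, Real.norm_eq_abs, sq_abs,
      Real.sq_sqrt zero_le_two]
    ring

lemma residueSum_oddPart (v : H) (n : ℕ) :
    residueSum (coeffSq expBasis (oddPart v)) (4 * (n : ℂ) ^ 2) = ‖sinCoeff n v‖ ^ 2 := by
  rcases eq_or_ne n 0 with rfl | hn
  · have h : (4 * ((0 : ℕ) : ℂ) ^ 2) = 0 := by simp
    rw [h, residueSum_zero, coeffSq, expBasis_repr_oddPart, sinCoeff_eq]
    simp
  · rw [residueSum_four_mul_sq hn, coeffSq, coeffSq, expBasis_repr_oddPart,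
      expBasis_repr_oddPart, neg_neg, sinCoeff_eq, norm_div, norm_div,
      norm_sub_rev (expBasis.repr v (-(n : ℤ)))]
    simp only [norm_mul, norm_div, mul_pow, div_pow, Complex.norm_real, Complex.norm_I,
      Complex.norm_ofNat, Real.norm_eq_abs, sq_abs, Real.sq_sqrt zero_le_two]
    ring

/-! ### Integration by parts and L₀ in Fourier coordinates -/

lemma absolutelyContinuousOnInterval_congr {f g : ℝ → ℂ} {a b : ℝ}
    (hg : AbsolutelyContinuousOnInterval g a b) (h : EqOn f g (uIcc a b)) :
    AbsolutelyContinuousOnInterval f a b := by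
  rw [absolutelyContinuousOnInterval_iff] at hg ⊢
  intro ε hε
  obtain ⟨δ, hδ, H⟩ := hg ε hε
  refine ⟨δ, hδ, fun E hE hlt => lt_of_eq_of_lt (Finset.sum_congr rfl fun i hi => ?_) (H E hE hlt)⟩
  have hmem := hE.1 i hi
  rw [h hmem.1, h hmem.2]

lemma absolutelyContinuousOnInterval_integral {f : ℝ → ℂ} {a b : ℝ}
    (hf : IntervalIntegrable f volume a b) :
    AbsolutelyContinuousOnInterval (fun x => ∫ t in a..x, f t) a b := by
  have hre : IntervalIntegrable (fun t => (f t).re) volume a b := ⟨hf.1.re, hf.2.re⟩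
  have him : IntervalIntegrable (fun t => (f t).im) volume a b := ⟨hf.1.im, hf.2.im⟩
  have hconst : ∀ c : ℂ, AbsolutelyContinuousOnInterval (fun _ : ℝ => c) a b := fun c =>
    (contDiffOn_const (n := 1)).absolutelyContinuousOnInterval
  have h := ((hre.absolutelyContinuousOnInterval_intervalIntegral left_mem_uIcc).smul
    (hconst 1)).add ((him.absolutelyContinuousOnInterval_intervalIntegral left_mem_uIcc).smul
    (hconst Complex.I))
  have heq : EqOn (fun x => ∫ t in a..x, f t) ((fun x => ∫ t in a..x, (f t).re) • (fun _ => (1 : ℂ))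
      + (fun x => ∫ t in a..x, (f t).im) • (fun _ => Complex.I)) (uIcc a b) := by
    intro x hx
    have hsub : uIcc a x ⊆ uIcc a b := uIcc_subset_uIcc_left hx
    have hfx := hf.mono_set hsub
    have h1 := intervalIntegral.intervalIntegral_re hfx
    have h2 := intervalIntegral.intervalIntegral_im hfx
    simp only [RCLike.re_to_complex, RCLike.im_to_complex] at h1 h2
    apply Complex.ext <;> simp [h1, h2]
  exact absolutelyContinuousOnInterval_congr h heq

/-- Integration by parts for a primitive of an integrable function and a `C¹` function. -/
lemma integral_mul_add_integral_mul_deriv {U f V V' : ℝ → ℂ} {b : ℝ} (hb : 0 ≤ b)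
    (hf : IntervalIntegrable f volume 0 b)
    (hU : ∀ x ∈ Icc 0 b, U x = U 0 + ∫ t in (0 : ℝ)..x, f t)
    (hV : ∀ x, HasDerivAt V (V' x) x) (hV' : Continuous V') :
    (∫ x in (0 : ℝ)..b, f x * V x) + ∫ x in (0 : ℝ)..b, U x * V' x = U b * V b - U 0 * V 0 := by
  have hVc : Continuous V := continuous_iff_continuousAt.2 fun x => (hV x).continuousAt
  have hV1 : ContDiff ℝ 1 V := by
    rw [contDiff_one_iff_deriv]
    refine ⟨fun x => (hV x).differentiableAt, ?_⟩
    rwa [funext fun x => (hV x).deriv]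
  set P : ℝ → ℂ := fun x => U 0 + ∫ t in (0 : ℝ)..x, f t with hP
  have hPac : AbsolutelyContinuousOnInterval P 0 b :=
    ((contDiffOn_const (n := 1)).absolutelyContinuousOnInterval).add
      (absolutelyContinuousOnInterval_integral hf)
  have hint1 : IntervalIntegrable (fun x => f x * V x) volume 0 b :=
    hf.mul_continuousOn hVc.continuousOn
  have hint2 : IntervalIntegrable (fun x => P x * V' x) volume 0 b :=
    (hPac.continuousOn.mul hV'.continuousOn).intervalIntegrable
  have hint := hint1.add hint2
  -- The difference between PV and the primitive of fV + PV' is absolutely continuous with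
  -- derivative zero almost everywhere, hence constant; its values at 0 and b give the formula.
  have hac := (hPac.fun_smul (hV1.contDiffOn.absolutelyContinuousOnInterval)).fun_sub
    (absolutelyContinuousOnInterval_integral hint)
  obtain ⟨C, hC⟩ := hac.const_of_ae_hasDerivAt_zero (by
    filter_upwards [hf.ae_hasDerivAt_integral, hint.ae_hasDerivAt_integral] with x hx1 hx2 hx
    have h1 := ((hx1 hx 0 left_mem_uIcc).const_add (U 0)).mul (hV x)
    have h2 := hx2 hx 0 left_mem_uIcc
    have h3 := h1.sub h2
    simp only [smul_eq_mul]
    convert! h3 using 1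
    simp [hP])
  have h0 := hC 0 left_mem_uIcc
  have hb' := hC b right_mem_uIcc
  have hcongr : ∫ x in (0 : ℝ)..b, U x * V' x = ∫ x in (0 : ℝ)..b, P x * V' x := by
    refine intervalIntegral.integral_congr fun x hx => ?_
    rw [uIcc_of_le hb] at hx
    simp only [hP, hU x hx]
  have hPb : P b = U b := (hU b ⟨hb, le_rfl⟩).symm
  have hP0 : P 0 = U 0 := by simp [hP]
  rw [hcongr]
  simp only [intervalIntegral.integral_same, smul_eq_mul, sub_zero, hP0] at h0
  simp only [smul_eq_mul, hPb] at hb'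
  rw [intervalIntegral.integral_add hint1 hint2] at hb'
  linear_combination h0 - hb'

lemma hasDerivAt_expMode (k : ℤ) (x : ℝ) :
    HasDerivAt (expMode k) (2 * Complex.I * k * expMode k x) x := by
  have h1 : HasDerivAt (fun x : ℝ => 2 * Complex.I * k * (x : ℂ)) (2 * Complex.I * k) x := by
    simpa using (Complex.ofRealCLM.hasDerivAt (x := x)).const_mul (2 * Complex.I * (k : ℂ))
  have h2 := (h1.cexp).div_const (√π : ℂ)
  convert! h2 using 1
  rw [expMode]
  ring

lemma expMode_pi (k : ℤ) : expMode k π = expMode k 0 := by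
  have := expMode_pi_sub k 0
  rw [sub_zero] at this
  rw [this, expMode, expMode]
  simp

/-- Two integrations by parts; the boundary terms cancel because u, u' and the mode each take equal
values at 0 and π. -/
lemma expBasis_repr_of_isSecondDeriv {y w : H} (h : IsSecondDeriv y w) (k : ℤ) :
    expBasis.repr w k = -(4 * (k : ℂ) ^ 2) * expBasis.repr y k := by
  obtain ⟨u, d, hy, hu, hd, hb, hc⟩ := h
  have hpi : π ∈ Icc (0 : ℝ) π := ⟨Real.pi_pos.le, le_rfl⟩
  have hcont : Continuous fun x => 2 * Complex.I * ((-k : ℤ) : ℂ) * expMode (-k) x :=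
    continuous_const.mul (continuous_expMode _)
  have h1 := integral_mul_add_integral_mul_deriv Real.pi_pos.le (intervalIntegrable_coe w hpi) hd
    (hasDerivAt_expMode (-k)) hcont
  have h2 := integral_mul_add_integral_mul_deriv Real.pi_pos.le
    (intervalIntegrable_of_primitive hd hpi) hu (hasDerivAt_expMode (-k)) hcont
  have hpull : ∀ f : ℝ → ℂ, ∫ x in (0 : ℝ)..π, f x * (2 * Complex.I * ((-k : ℤ) : ℂ)
      * expMode (-k) x) = 2 * Complex.I * ((-k : ℤ) : ℂ) * ∫ x in (0 : ℝ)..π,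
        f x * expMode (-k) x := by
    intro f
    rw [← intervalIntegral.integral_const_mul]
    congr 1
    ext x
    ring
  rw [hpull, expMode_pi, ← hc, sub_self] at h1
  rw [hpull, expMode_pi, ← hb, sub_self] at h2
  have h3 : ∫ x in (0 : ℝ)..π, y x * expMode (-k) x = ∫ x in (0 : ℝ)..π, u x * expMode (-k) x := by
    refine integral_congr_of_ae_mu ?_
    filter_upwards [hy] with x hx
    rw [hx]
  rw [expBasis_repr, expBasis_repr, h3]
  push_cast at h1 h2
  linear_combination h1 + 2 * Complex.I * k * h2 + 4 * (k : ℂ) ^ 2 *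
    (∫ x in (0 : ℝ)..π, u x * expMode (-k) x) * Complex.I_sq

lemma expBasis_repr_zero (f : H) :
    expBasis.repr f 0 = (∫ x in (0 : ℝ)..π, f x) / √π := by
  rw [expBasis_repr, ← intervalIntegral.integral_div]
  congr 1
  ext x
  simp [expMode, div_eq_mul_inv]

/-- The equation `y'' = w` with periodic boundary conditions is solvable if `w` has mean zero. -/
lemma exists_isSecondDeriv {w : H} (hw : expBasis.repr w 0 = 0) : ∃ y, IsSecondDeriv y w := by
  have hpi : π ∈ Icc (0 : ℝ) π := ⟨Real.pi_pos.le, le_rfl⟩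
  have hw0 : ∫ x in (0 : ℝ)..π, w x = 0 := by
    rw [expBasis_repr_zero, div_eq_zero_iff] at hw
    exact hw.resolve_right (Complex.ofReal_ne_zero.2 (Real.sqrt_pos.2 Real.pi_pos).ne')
  set p : ℝ → ℂ := fun x => ∫ t in (0 : ℝ)..x, w t with hp
  have hpc : ContinuousOn p (Icc 0 π) :=
    continuousOn_of_primitive (intervalIntegrable_coe w hpi) fun x _ => by simp [hp]
  have hpi' : IntervalIntegrable p volume 0 π := by
    apply ContinuousOn.intervalIntegrable
    rwa [uIcc_of_le Real.pi_pos.le]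
  -- The initial slope that gives d integral zero, so that u(π) = u(0); mean zero of w gives d(π) =
  -- d(0).
  set c : ℂ := -(∫ t in (0 : ℝ)..π, p t) / π with hc
  set d : ℝ → ℂ := fun x => c + p x with hd
  have hdi : IntervalIntegrable d volume 0 π := intervalIntegrable_const.add hpi'
  set u : ℝ → ℂ := fun x => ∫ t in (0 : ℝ)..x, d t with hu
  have huc : ContinuousOn u (Icc 0 π) := continuousOn_of_primitive hdi fun x _ => by simp [hu]
  have hpine : (π : ℂ) ≠ 0 := by exact_mod_cast Real.pi_ne_zero
  refine ⟨(memLp_of_continuousOn huc).toLp, u, d, MemLp.coeFn_toLp _, ?_, ?_, ?_, ?_⟩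
  · intro x _
    simp [hu]
  · intro x _
    simp [hd, hp]
  · simp only [hu, hd, intervalIntegral.integral_same]
    rw [intervalIntegral.integral_add intervalIntegrable_const hpi',
      intervalIntegral.integral_const, hc, sub_zero, Complex.real_smul]
    field_simp
    ring
  · simp [hd, hp, hw0]

lemma isSecondDeriv_expLp_zero : IsSecondDeriv (expLp 0) 0 := by
  have h0 : ((0 : H) : ℝ → ℂ) =ᵐ[mu] 0 := Lp.coeFn_zero ℂ 2 mu
  refine ⟨expMode 0, 0, coeFn_expLp 0, ?_, ?_, (expMode_pi 0).symm, rfl⟩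
  · intro x _
    simp [expMode]
  · intro x hx
    have : ∫ t in (0 : ℝ)..x, ((0 : H) : ℝ → ℂ) t = 0 := by
      rw [intervalIntegral.integral_of_le hx.1, integral_Ioc_eq_integral_Ioo]
      exact integral_eq_zero_of_ae
        (ae_restrict_of_ae_restrict_of_subset (Ioo_subset_Ioo_right hx.2) h0)
    change (0 : ℂ) = 0 + ∫ t in (0 : ℝ)..x, ((0 : H) : ℝ → ℂ) t
    rw [this, add_zero]

/-- For the converse, the relation at k = 0 says that w has mean zero, so y₀'' = w is solvable. Then
y and y₀ share all coefficients with k ≠ 0 and differ by a constant, which lies in the kernel of L₀.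
-/
lemma isSecondDeriv_iff {y w : H} : IsSecondDeriv y w ↔
    ∀ k : ℤ, expBasis.repr w k = -(4 * (k : ℂ) ^ 2) * expBasis.repr y k := by
  refine ⟨expBasis_repr_of_isSecondDeriv, fun h => ?_⟩
  obtain ⟨y₀, hy₀⟩ := exists_isSecondDeriv (w := w) (by simpa using h 0)
  have hy₀' := expBasis_repr_of_isSecondDeriv hy₀
  have hdiff : y = y₀ + expBasis.repr (y - y₀) 0 • expLp 0 := by
    rw [← sub_eq_zero]
    refine eq_zero_of_repr_eq_zero (b := expBasis) fun k => ?_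
    rw [← expBasis_apply]
    simp only [map_sub, map_add, map_smul, lp.coeFn_sub, lp.coeFn_add, lp.coeFn_smul, Pi.sub_apply,
      Pi.add_apply, Pi.smul_apply, smul_eq_mul, HilbertBasis.repr_self]
    rcases eq_or_ne k 0 with rfl | hk
    · simp
    · rw [lp.single_apply_ne _ _ _ hk]
      have h4 : (4 * (k : ℂ) ^ 2) ≠ 0 :=
        mul_ne_zero (by norm_num) (pow_ne_zero _ (Int.cast_ne_zero.2 hk))
      have h5 : (4 * (k : ℂ) ^ 2) * (expBasis.repr y k - expBasis.repr y₀ k) = 0 := by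
        linear_combination h k - hy₀' k
      simpa [sub_eq_zero] using (mul_eq_zero.1 h5).resolve_left h4
  have h1 : (y₀, -w) ∈ graphL0 := by
    change IsSecondDeriv y₀ (- -w)
    rwa [neg_neg]
  have h2 : (expLp 0, 0) ∈ graphL0 := by
    change IsSecondDeriv (expLp 0) (-0)
    rw [neg_zero]
    exact isSecondDeriv_expLp_zero
  have h3 := graphL0.add_mem h1 (graphL0.smul_mem (expBasis.repr (y - y₀) 0) h2)
  have h4 : IsSecondDeriv (y₀ + expBasis.repr (y - y₀) 0 • expLp 0)
      (-(-w + expBasis.repr (y - y₀) 0 • 0)) := h3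
  rwa [← hdiff, smul_zero, add_zero, neg_neg] at h4

/-! ### Eigenspaces and spectra of L(α, v) -/

lemma isSecondDeriv_L0 (y : L0.domain) : IsSecondDeriv (y : H) (-(L0 y)) := by
  have : ((y : H), L0 y) ∈ L0.graph := L0.mem_graph y
  rw [graph_L0] at this
  exact this

lemma exists_L0_eq {y f : H} (h : IsSecondDeriv y (-f)) :
    ∃ y' : L0.domain, (y' : H) = y ∧ L0 y' = f := by
  have : (y, f) ∈ L0.graph := by
    rw [graph_L0]
    exact h
  obtain ⟨y', h1, h2⟩ := (LinearPMap.mem_graph_iff L0).1 this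
  exact ⟨y', h1, h2⟩

/-- The eigenspaces of `L(α, v)` in Fourier coordinates. -/
lemma map_ker_shift (α : ℝ) (v : H) (z : ℂ) :
    (LinearMap.ker (shift (L α v) z)).map (L α v).domain.subtype
      = perturbedEigenspace expBasis α v z := by
  ext y
  constructor
  · rintro ⟨y, hy, rfl⟩ k
    have hy' : L0 y + ((α : ℂ) * inner ℂ v (y : H)) • v - z • (y : H) = 0 := hy
    have h1 := isSecondDeriv_iff.1 (isSecondDeriv_L0 y) k
    have h2 := congrArg (fun f => expBasis.repr f k) hy'
    simp only [map_sub, map_add, map_smul, map_neg, map_zero, lp.coeFn_sub, lp.coeFn_add,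
      lp.coeFn_smul, lp.coeFn_neg, lp.coeFn_zero, Pi.sub_apply, Pi.add_apply, Pi.smul_apply,
      Pi.neg_apply, Pi.zero_apply, smul_eq_mul] at h1 h2
    rw [Submodule.subtype_apply]
    linear_combination h1 + h2
  · intro hy
    have hsd : IsSecondDeriv y (-(z • y - ((α : ℂ) * inner ℂ v y) • v)) := by
      refine isSecondDeriv_iff.2 fun k => ?_
      simp only [map_sub, map_smul, map_neg, lp.coeFn_sub,
        lp.coeFn_smul, lp.coeFn_neg, Pi.sub_apply, Pi.smul_apply,
        Pi.neg_apply, smul_eq_mul]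
      linear_combination hy k
    obtain ⟨y', rfl, h2⟩ := exists_L0_eq hsd
    refine ⟨y', ?_, rfl⟩
    change L0 y' + ((α : ℂ) * inner ℂ v (y' : H)) • v - z • (y' : H) = 0
    rw [h2]
    simp

lemma multiplicity_eq (α : ℝ) (v : H) (z : ℂ) :
    multiplicity (L α v) z = Module.finrank ℂ (perturbedEigenspace expBasis α v z) := by
  rw [← map_ker_shift, multiplicity, Submodule.finrank_map_subtype_eq]

lemma multiplicity_eq_zero_of_mem_resolventSet {T : H →ₗ.[ℂ] H} {z : ℂ}
    (h : z ∈ resolventSet T) : multiplicity T z = 0 := by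
  obtain ⟨R, -, hR⟩ := h
  have hker : LinearMap.ker (shift T z) = ⊥ := by
    rw [LinearMap.ker_eq_bot']
    intro y hy
    have := hR y
    rw [hy, map_zero] at this
    exact Subtype.ext this.symm
  rw [multiplicity, hker, finrank_bot]

/-- Off the common spectrum both kernels are trivial, so the comparison extends to every z. -/
lemma SameSpectrum.multiplicity_eq {T S : H →ₗ.[ℂ] H} (h : SameSpectrum T S) (z : ℂ) :
    multiplicity T z = multiplicity S z := by
  by_cases hz : z ∈ spectrumOf T
  · exact h.2 z hz
  · have hz' : z ∉ spectrumOf S := h.1 ▸ hz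
    rw [multiplicity_eq_zero_of_mem_resolventSet (not_not.1 hz),
      multiplicity_eq_zero_of_mem_resolventSet (not_not.1 hz')]

lemma SameSpectrum.residueSum_eq {α β : ℝ} {v w : H} (h : SameSpectrum (L α v) (L β w)) (z : ℂ) :
    α * residueSum (coeffSq expBasis v) z = β * residueSum (coeffSq expBasis w) z := by
  refine residueSum_eq_of_shiftIndex_eq (coeffSq_nonneg _ _) (summable_coeffSq _ _)
    (coeffSq_nonneg _ _) (summable_coeffSq _ _) (fun z => ?_) z
  have h1 := h.multiplicity_eq z
  rw [NonlocalPeriodic.multiplicity_eq, NonlocalPeriodic.multiplicity_eq] at h1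
  have h2 := finrank_perturbedEigenspace expBasis α v z
  have h3 := finrank_perturbedEigenspace expBasis β w z
  -- The unperturbed multiplicity is common to both sides and cancels.
  omega

end NonlocalPeriodic

end

/-- The numbers `α |c_k(v)|²` and `α |s_k(v)|²` are uniquely determined by the two spectra
(with multiplicities) of `L(α, v₊)` and `L(α, v₋)`. -/
theorem theorem4p1 (α β : ℝ) (v w : NonlocalPeriodic.H)
    (hplus : NonlocalPeriodic.SameSpectrum
      (NonlocalPeriodic.L α (NonlocalPeriodic.evenPart v))
      (NonlocalPeriodic.L β (NonlocalPeriodic.evenPart w)))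
    (hminus : NonlocalPeriodic.SameSpectrum
      (NonlocalPeriodic.L α (NonlocalPeriodic.oddPart v))
      (NonlocalPeriodic.L β (NonlocalPeriodic.oddPart w))) :
    ∀ k : ℕ,
      α * ‖NonlocalPeriodic.cosCoeff k v‖ ^ 2 = β * ‖NonlocalPeriodic.cosCoeff k w‖ ^ 2 ∧
      α * ‖NonlocalPeriodic.sinCoeff k v‖ ^ 2 = β * ‖NonlocalPeriodic.sinCoeff k w‖ ^ 2 := by
  intro n
  rw [← NonlocalPeriodic.residueSum_evenPart, ← NonlocalPeriodic.residueSum_evenPart,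
    ← NonlocalPeriodic.residueSum_oddPart, ← NonlocalPeriodic.residueSum_oddPart]
  exact ⟨hplus.residueSum_eq _, hminus.residueSum_eq _⟩
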